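/- **Corollary 3.4.** Let $m,\tilde m\ge 0$ and $n\ge 0$ be integers with $n$ even. Call $A_{(m,\tilde m,1^n)}$ any configuration of pairwise non-collinear real unit vectors $\alpha_i=(\cos\varphi_i,\sin\varphi_i)\in\mathbb R^2$, $0\le i\le n+1$, with multiplicities $m_0=m$, $m_{n+1}=\tilde m$ and $m_i=1$ for $1\le i\le n$, such that $\alpha_0\perp\alpha_{n+1}$, the collection of lines $(\alpha_i,x)=0$ is symmetric under the reflection about $\alpha_0$, and, with $z_i=e^{2\sqrt{-1}\,\varphi_i}$, $$\sum_{i\ne j} m_i\,\frac{z_i+z_j}{z_i-z_j}=0\qquad (1\le j\le n).$$ Such a configuration exists. For every such configuration and every integer $q\ge 1$, let $A^q_{(m,\tilde m,1^n)}=T_q(A_{(m,\tilde m,1^n)})$ consist of the vectors $\alpha_{i,s}=(\cos\varphi_{i,s},\sin\varphi_{i,s})$, $\varphi_{i,s}=(\varphi_i+\pi s)/q$, $0\le i\le n+1$, $1\le s\le q$, where $\alpha_{i,s}$ has multiplicity $m_{i,s}=m_i$. Then: 1. The vectors $\alpha_{i,s}$ are pairwise non-collinear, and $A^q_{(m,\tilde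 m,1^n)}$ admits the Baker–Akhiezer function: there is a function $\phi(\lambda,x)=P(\lambda,x)e^{(\lambda,x)}$ of $\lambda,x\in\mathbb C^2$, where $(\cdot,\cdot)$ is the standard bilinear product and $P$ is a polynomial in $(\lambda,x)$ whose highest term (homogeneous component of top degree) is $\prod_{i,s}(\alpha_{i,s},\lambda)^{m_{i,s}}(\alpha_{i,s},x)^{m_{i,s}}$, such that for all $i,s$ and all $1\le r\le m_{i,s}$ the normal derivative $\partial_{\alpha_{i,s}}^{2r-1}\phi(\lambda,x)$ in $x$ vanishes for all $\lambda$ on the line $(\alpha_{i,s},x)=0$ in $\mathbb C^2$. 2. The real lines $(\alpha_{i,s},x)=0$ are the mirrors of a dihedral group $I_2(2q)$ of order $4q$, which form two orbits of this group, one with all multiplicities equal to $m$ and one with all multiplicities equal to $\tilde m$, together with $n/2$ further pairwise disjoint $I_2(2q)$-orbits of lines, containing no mirrors, on which all multiplicities are $1$. (Lines of multiplicity $0$, if $m=0$ or $\tilde m=0$, are counted as lines of the configuration.) -/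

import Mathlib

open scoped BigOperators

noncomputable section

namespace BakerAkhiezer

/-! ### The Baker-Akhiezer function of a configuration in `ℂ^N` -/

/-- A configuration of vectors in `ℂ^N`: the vectors are non-isotropic and pairwise
non-collinear.  The bilinear (not Hermitian) product `(x, y) = ∑ xᵢ yᵢ` is `x ⬝ᵥ y`. -/
def IsConfiguration {N : ℕ} {ι : Type*} (α : ι → Fin N → ℂ) : Prop :=
  (∀ i, α i ⬝ᵥ α i ≠ 0) ∧ Pairwise fun i j => LinearIndependent ℂ ![α i, α j]

/-- The linear form `(α, λ)`, as a polynomial in the variables `(λ, x)`. -/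
def formLam {N : ℕ} (α : Fin N → ℂ) : MvPolynomial (Fin N ⊕ Fin N) ℂ :=
  ∑ k, MvPolynomial.C (α k) * MvPolynomial.X (Sum.inl k)

/-- The linear form `(α, x)`, as a polynomial in the variables `(λ, x)`. -/
def formX {N : ℕ} (α : Fin N → ℂ) : MvPolynomial (Fin N ⊕ Fin N) ℂ :=
  ∑ k, MvPolynomial.C (α k) * MvPolynomial.X (Sum.inr k)

/-- `Φ(lam, x)` is a Baker-Akhiezer function of the vectors `α i` with multiplicities `m i`:
* `Φ(lam, x) = P(lam, x) e^{(lam, x)}` with a polynomial `P` in `lam` and `x` whose highest term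
  (the homogeneous part of top degree `2 ∑ m i`) is `∏ (α i, lam)^{m i} (α i, x)^{m i}`;
* for every `i` and `1 ≤ s ≤ m i` the derivative of order `2 s - 1` of `Φ` in `x` in the
  direction `α i` vanishes on the hyperplane `(α i, x) = 0`. -/
def IsBAFunction {N : ℕ} {ι : Type*} [Fintype ι] (α : ι → Fin N → ℂ) (m : ι → ℕ)
    (Φ : (Fin N → ℂ) → (Fin N → ℂ) → ℂ) : Prop :=
  (∃ P : MvPolynomial (Fin N ⊕ Fin N) ℂ,
      P.totalDegree ≤ 2 * ∑ i, m i ∧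
      MvPolynomial.homogeneousComponent (2 * ∑ i, m i) P =
        ∏ i, (formLam (α i) ^ m i * formX (α i) ^ m i) ∧
      ∀ lam x, Φ lam x = MvPolynomial.eval (Sum.elim lam x) P * Complex.exp (lam ⬝ᵥ x)) ∧
  ∀ i, ∀ s : ℕ, 1 ≤ s → s ≤ m i → ∀ lam x : Fin N → ℂ, α i ⬝ᵥ x = 0 →
    iteratedDeriv (2 * s - 1) (fun t : ℂ => Φ lam (x + t • α i)) 0 = 0

/-- The vectors `α i` with multiplicities `m i` admit the Baker-Akhiezer function. -/
def AdmitsBA {N : ℕ} {ι : Type*} [Fintype ι] (α : ι → Fin N → ℂ) (m : ι → ℕ) : Prop :=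
  ∃ Φ : (Fin N → ℂ) → (Fin N → ℂ) → ℂ, IsBAFunction α m Φ

/-! ### Real planar configurations, given by polar angles -/

/-- The Euclidean plane. -/
abbrev Plane : Type := EuclideanSpace ℝ (Fin 2)

/-- The unit vector `(cos φ, sin φ)`. -/
def polar (φ : ℝ) : Plane := !₂[Real.cos φ, Real.sin φ]

/-- The line through the origin with normal vector `(cos φ, sin φ)`. -/
def normalLine (φ : ℝ) : Submodule ℝ Plane := (Submodule.span ℝ {polar φ})ᗮ

/-- A finite family of real unit vectors `(cos φᵢ, sin φᵢ)`, given by the angles `φᵢ`, with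
multiplicities. -/
structure PlanarConfig (ι : Type*) where
  angle : ι → ℝ
  mult : ι → ℕ

namespace PlanarConfig

variable {ι : Type*}

/-- The vector `αᵢ = (cos φᵢ, sin φᵢ)`. -/
def vec (A : PlanarConfig ι) (i : ι) : Plane := polar (A.angle i)

/-- The vector `αᵢ`, as a vector in `ℂ²`. -/
def cvec (A : PlanarConfig ι) (i : ι) : Fin 2 → ℂ := fun k => ((A.vec i k : ℝ) : ℂ)

/-- The line `(αᵢ, x) = 0` of the arrangement. -/
def line (A : PlanarConfig ι) (i : ι) : Submodule ℝ Plane := normalLine (A.angle i)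

/-- The coordinate `zᵢ = e^{2 i φᵢ}`. -/
def z (A : PlanarConfig ι) (i : ι) : ℂ := Complex.exp (2 * Complex.I * (A.angle i : ℂ))

/-- `T_q(A)`: each `αᵢ` is replaced by the `q` vectors with angles `(φᵢ + π s) / q`,
`s = 1, …, q`, of the same multiplicity. -/
def T (q : ℕ) (A : PlanarConfig ι) : PlanarConfig (ι × Fin q) where
  angle a := (A.angle a.1 + Real.pi * ((a.2 : ℕ) + 1)) / q
  mult a := A.mult a.1

end PlanarConfig

/-- `A` is the configuration `A_(m, m', 1^n)`: pairwise non-collinear real vectors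
`α₀, …, α_{n+1}` of multiplicities `m, 1, …, 1, m'`, with `α₀` orthogonal to `α_{n+1}`, the
arrangement of lines symmetric under the reflection about `α₀`, and
`∑_{i ≠ j} mᵢ (zᵢ + zⱼ) / (zᵢ - zⱼ) = 0` for `j = 1, …, n`. -/
structure IsAmm (m m' n : ℕ) (A : PlanarConfig (Fin (n + 2))) : Prop where
  mult_zero : A.mult 0 = m
  mult_last : A.mult (Fin.last (n + 1)) = m'
  mult_one : ∀ i, i ≠ 0 → i ≠ Fin.last (n + 1) → A.mult i = 1
  noncollinear : Pairwise fun i j => LinearIndependent ℝ ![A.vec i, A.vec j]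
  orthogonal : inner ℝ (A.vec 0) (A.vec (Fin.last (n + 1))) = 0
  symmetric : (fun ℓ : Submodule ℝ Plane =>
      ℓ.map ((A.line 0).reflection.toLinearEquiv : Plane →ₗ[ℝ] Plane)) '' Set.range A.line
        = Set.range A.line
  locus : ∀ j, j ≠ 0 → j ≠ Fin.last (n + 1) →
    ∑ i ∈ Finset.univ.erase j, (A.mult i : ℂ) * ((A.z i + A.z j) / (A.z i - A.z j)) = 0

/-! ### Dihedral groups acting on the lines of the plane -/

/-- The dihedral group `I₂(k)` (of order `2 k`), generated by the reflections in the `k` lines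
with normal angles `θ + π j / k`, `0 ≤ j < k`. -/
def dihedralI2 (k : ℕ) (θ : ℝ) : Subgroup (Plane ≃ₗᵢ[ℝ] Plane) :=
  Subgroup.closure (Set.range fun j : Fin k =>
    (normalLine (θ + Real.pi * (j : ℕ) / k)).reflection)

/-- The mirrors of a group of isometries of the plane: the lines whose reflection it contains. -/
def mirrors (G : Subgroup (Plane ≃ₗᵢ[ℝ] Plane)) : Set (Submodule ℝ Plane) :=
  {ℓ | Module.finrank ℝ ℓ = 1 ∧ ℓ.reflection ∈ G}

/-- `O` is the orbit of a line through the origin under the group `G`. -/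
def IsLineOrbit (G : Subgroup (Plane ≃ₗᵢ[ℝ] Plane)) (O : Set (Submodule ℝ Plane)) : Prop :=
  ∃ ℓ : Submodule ℝ Plane, Module.finrank ℝ ℓ = 1 ∧
    O = {ℓ' | ∃ g ∈ G, ℓ' = ℓ.map (g.toLinearEquiv : Plane →ₗ[ℝ] Plane)}

/-- The arrangement of lines of `B` consists of the mirrors of `I₂(2 q)`, which form two orbits,
one with multiplicity `m` and one with multiplicity `m'`, and of `r` further orbits of `I₂(2 q)`
with multiplicity `1`. -/
def IsDihedralArrangement {κ : Type*} (q m m' r : ℕ) (B : PlanarConfig κ) : Prop :=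
  ∃ (θ : ℝ) (M M' : Set (Submodule ℝ Plane)) (O : Fin r → Set (Submodule ℝ Plane)),
    IsLineOrbit (dihedralI2 (2 * q) θ) M ∧ IsLineOrbit (dihedralI2 (2 * q) θ) M' ∧
    Disjoint M M' ∧ M ∪ M' = mirrors (dihedralI2 (2 * q) θ) ∧
    (∀ k, IsLineOrbit (dihedralI2 (2 * q) θ) (O k)) ∧
    (Pairwise fun k l => Disjoint (O k) (O l)) ∧
    (∀ k, Disjoint (O k) (mirrors (dihedralI2 (2 * q) θ))) ∧
    Set.range B.line = mirrors (dihedralI2 (2 * q) θ) ∪ ⋃ k, O k ∧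
    (∀ a, B.line a ∈ M → B.mult a = m) ∧
    (∀ a, B.line a ∈ M' → B.mult a = m') ∧
    ∀ k a, B.line a ∈ O k → B.mult a = 1

end BakerAkhiezer

end

/-! The Baker–Akhiezer function comes from Berest's formula: with M = ∑ mᵢ and δ = ∏ (αᵢ,x)^mᵢ,
apply (L - λ²)^M to δ² e^{(λ,x)}, where L = Δ - ∑ 2 mᵢ (αᵢ,x)⁻¹ ∂_{αᵢ} is the gauged Calogero–Moser
operator. Conjugating by the exponential turns ∂_v into `twistedDeriv v` on polynomials in (λ,x),
and vanishing of odd normal derivatives becomes divisibility by (αᵢ,x), i.e. `IsQuasiInvariant`.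

The polynomial δ² is quasi-invariant because of its high-order zeros. Quasi-invariance survives L -
λ² (`IsQuasiInvariant.gaugedLaplacian`) when the locus equations ∑_{j≠i} mⱼ cot^{2r-1}(φⱼ-φᵢ) = 0, 1
≤ r ≤ mᵢ, hold; the heart of this is `formX_dvd_weighted_sum`. In top degree one step sends δh to
2δ(λ,∂ₓ)h, because ∑ mᵢ (αᵢ,λ)/(αᵢ,x) is the logarithmic derivative of δ along λ. After M steps the
factor δ has become 2^M M! ∏ (αᵢ,λ)^mᵢ, which gives the required highest term up to a constant
(`admitsBA_of_locusEquations`).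

The locus equations for T_q(A) (`locusEquations_T`) have two sources. Over α₀ and α_{n+1} the
unfolded arrangement is symmetric in the line itself, so odd cotangent sums cancel in pairs. Over
the other lines only r = 1 occurs, and ∑ₛ cot(x + πs/q) = q cot(qx) reduces it to the given equation
for A.

Existence (`exists_isAmm`) is Stieltjes' electrostatics: in the coordinate u = sin² φ the equations
for angles 0, ±φₖ, π/2 are the critical equations of a product of powers on the unit cube, and its
maximum lies off the walls and diagonals.

For the orbits, the lines over αᵢ have normal angles φᵢ/q modulo π/q. With θ = φ₀/q, rotations in
I₂(2q) preserve this family and reflections exchange it with the family over the mirror image of αᵢ.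
The self-paired families are the two classes of mirrors; the others pair off into n/2 orbits. -/

noncomputable section

namespace BakerAkhiezer

open MvPolynomial

/-! ### Twisted directional derivatives -/

section Twisted

variable {N : ℕ}

/-- The derivative in `x` in the direction `v`, on polynomials in `(λ, x)`. -/
def dirDeriv (v : Fin N → ℂ) :
    Derivation ℂ (MvPolynomial (Fin N ⊕ Fin N) ℂ) (MvPolynomial (Fin N ⊕ Fin N) ℂ) :=
  ∑ k, v k • pderiv (Sum.inr k)

/-- The operator `e^{-(λ,x)} ∘ ∂_v ∘ e^{(λ,x)}` on polynomials in `(λ, x)`. -/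
def twistedDeriv (v : Fin N → ℂ) :
    MvPolynomial (Fin N ⊕ Fin N) ℂ →ₗ[ℂ] MvPolynomial (Fin N ⊕ Fin N) ℂ :=
  (dirDeriv v).toLinearMap + LinearMap.mulLeft ℂ (formLam v)

lemma dirDeriv_apply (v : Fin N → ℂ) (p : MvPolynomial (Fin N ⊕ Fin N) ℂ) :
    dirDeriv v p = ∑ k, v k • pderiv (Sum.inr k) p := by
  simp only [dirDeriv, ← Derivation.coeFnAddMonoidHom_apply, map_sum, Finset.sum_apply]
  simp

lemma twistedDeriv_apply (v : Fin N → ℂ) (p : MvPolynomial (Fin N ⊕ Fin N) ℂ) :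
    twistedDeriv v p = dirDeriv v p + formLam v * p := rfl

lemma formLam_comb (a b : ℂ) (v w : Fin N → ℂ) :
    formLam (a • v + b • w) = a • formLam v + b • formLam w := by
  simp only [formLam, Finset.smul_sum, ← Finset.sum_add_distrib]
  refine Finset.sum_congr rfl fun k _ => ?_
  simp [smul_eq_C_mul]; ring

lemma formX_comb (a b : ℂ) (v w : Fin N → ℂ) :
    formX (a • v + b • w) = a • formX v + b • formX w := by
  simp only [formX, Finset.smul_sum, ← Finset.sum_add_distrib]
  refine Finset.sum_congr rfl fun k _ => ?_
  simp [smul_eq_C_mul]; ring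

lemma dirDeriv_comb (a b : ℂ) (v w : Fin N → ℂ) (p : MvPolynomial (Fin N ⊕ Fin N) ℂ) :
    dirDeriv (a • v + b • w) p = a • dirDeriv v p + b • dirDeriv w p := by
  simp only [dirDeriv_apply, Finset.smul_sum, ← Finset.sum_add_distrib]
  refine Finset.sum_congr rfl fun k _ => ?_
  simp [add_smul, mul_smul]

lemma twistedDeriv_comb (a b : ℂ) (v w : Fin N → ℂ) (p : MvPolynomial (Fin N ⊕ Fin N) ℂ) :
    twistedDeriv (a • v + b • w) p = a • twistedDeriv v p + b • twistedDeriv w p := by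
  simp only [twistedDeriv_apply, dirDeriv_comb, formLam_comb, smul_eq_C_mul]
  ring

lemma dirDeriv_formX (v w : Fin N → ℂ) : dirDeriv v (formX w) = C (v ⬝ᵥ w) := by
  simp only [dirDeriv_apply, formX, map_sum, dotProduct]
  refine Finset.sum_congr rfl fun k _ => ?_
  rw [Finset.sum_eq_single k]
  · simp [smul_eq_C_mul]
  · intro b _ hb
    simp [pderiv_X, hb]
  · simp

lemma dirDeriv_formLam (v w : Fin N → ℂ) : dirDeriv v (formLam w) = 0 := by
  simp [dirDeriv_apply, formLam, pderiv_X]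

/-- The commutator of two derivations is a derivation, so it is enough that it kills the variables.
-/
lemma pderiv_comm' (i j : Fin N ⊕ Fin N) (p : MvPolynomial (Fin N ⊕ Fin N) ℂ) :
    pderiv i (pderiv j p) = pderiv j (pderiv i p) := by
  let D : Fin N ⊕ Fin N → Derivation ℂ (MvPolynomial (Fin N ⊕ Fin N) ℂ)
      (MvPolynomial (Fin N ⊕ Fin N) ℂ) := fun l => pderiv l
  have h : ⁅D i, D j⁆ = 0 := by
    apply MvPolynomial.derivation_ext
    intro k
    simp [D, Derivation.commutator_apply, pderiv_X, Pi.single_apply, apply_ite]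
  have := DFunLike.congr_fun h p
  simpa [D, Derivation.commutator_apply, sub_eq_zero] using this

lemma dirDeriv_dirDeriv_comm (v w : Fin N → ℂ) (p : MvPolynomial (Fin N ⊕ Fin N) ℂ) :
    dirDeriv v (dirDeriv w p) = dirDeriv w (dirDeriv v p) := by
  simp only [dirDeriv_apply, map_sum, Derivation.map_smul, Finset.smul_sum]
  rw [Finset.sum_comm]
  refine Finset.sum_congr rfl fun k _ => Finset.sum_congr rfl fun l _ => ?_
  rw [pderiv_comm', smul_comm]

lemma twistedDeriv_comm (v w : Fin N → ℂ) : Commute (twistedDeriv v) (twistedDeriv w) := by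
  refine LinearMap.ext fun p => ?_
  simp only [Module.End.mul_apply, twistedDeriv_apply, map_add, Derivation.leibniz, smul_eq_mul,
    dirDeriv_formLam, dirDeriv_dirDeriv_comm v w p]
  ring

lemma twistedDeriv_comm_apply (v w : Fin N → ℂ) (p : MvPolynomial (Fin N ⊕ Fin N) ℂ) :
    twistedDeriv v (twistedDeriv w p) = twistedDeriv w (twistedDeriv v p) :=
  LinearMap.congr_fun (twistedDeriv_comm v w).eq p

lemma twistedDeriv_mul (v : Fin N → ℂ) (f p : MvPolynomial (Fin N ⊕ Fin N) ℂ) :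
    twistedDeriv v (f * p) = dirDeriv v f * p + f * twistedDeriv v p := by
  simp only [twistedDeriv_apply, Derivation.leibniz, smul_eq_mul]
  ring

/-- Leibniz' rule has only two terms because a linear form has constant derivative. At `k = 0` the
truncated exponent `k - 1` is harmless, its coefficient being zero. -/
lemma twistedDeriv_pow_formX_mul (v w : Fin N → ℂ) (p : MvPolynomial (Fin N ⊕ Fin N) ℂ) (k : ℕ) :
    (twistedDeriv v ^ k) (formX w * p) =
      formX w * (twistedDeriv v ^ k) p +
        (k : ℂ) • (v ⬝ᵥ w) • (twistedDeriv v ^ (k - 1)) p := by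
  induction k with
  | zero => simp
  | succ k ih =>
    rw [pow_succ', Module.End.mul_apply, ih, map_add, twistedDeriv_mul, dirDeriv_formX, map_smul,
      map_smul]
    rcases k with _ | k
    · simp [smul_eq_C_mul, add_comm]
    · simp only [Nat.add_sub_cancel, pow_succ' _ k, Module.End.mul_apply,
        smul_eq_C_mul]
      push_cast
      simp only [map_add, map_one]
      ring

lemma twistedDeriv_pow_mul_of_dirDeriv_eq_zero (v : Fin N → ℂ)
    {f : MvPolynomial (Fin N ⊕ Fin N) ℂ} (hf : dirDeriv v f = 0)
    (p : MvPolynomial (Fin N ⊕ Fin N) ℂ) (k : ℕ) :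
    (twistedDeriv v ^ k) (f * p) = f * (twistedDeriv v ^ k) p := by
  induction k with
  | zero => simp
  | succ k ih => rw [pow_succ', Module.End.mul_apply, ih, twistedDeriv_mul, hf]; simp

lemma dvd_twistedDeriv_of_dvd {v w : Fin N → ℂ} (h : v ⬝ᵥ w = 0)
    {p : MvPolynomial (Fin N ⊕ Fin N) ℂ} (hp : formX w ∣ p) : formX w ∣ twistedDeriv v p := by
  obtain ⟨r, rfl⟩ := hp
  rw [twistedDeriv_mul, dirDeriv_formX, h]
  simp

lemma pow_dvd_twistedDeriv_pow (v : Fin N → ℂ) (f : MvPolynomial (Fin N ⊕ Fin N) ℂ) (k : ℕ) :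
    ∀ (l : ℕ) (p : MvPolynomial (Fin N ⊕ Fin N) ℂ), f ^ (l + k) ∣ p →
      f ^ l ∣ (twistedDeriv v ^ k) p := by
  induction k with
  | zero => intro l p h; simpa using h
  | succ k ih =>
    intro l p h
    rw [pow_succ, Module.End.mul_apply]
    apply ih
    obtain ⟨r, rfl⟩ := h
    rw [twistedDeriv_mul, ← add_assoc, Derivation.leibniz_pow]
    refine dvd_add ?_ (Dvd.dvd.mul_right (pow_dvd_pow _ (by omega)) _)
    simp only [Nat.add_sub_cancel, nsmul_eq_mul, smul_eq_mul]
    exact Dvd.intro (↑(l + k + 1) * dirDeriv v f * r) (by ring)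

/-! ### Evaluation -/

lemma eval_formX (v lam x : Fin N → ℂ) : eval (Sum.elim lam x) (formX v) = v ⬝ᵥ x := by
  simp [formX, dotProduct]

lemma eval_formLam (v lam x : Fin N → ℂ) : eval (Sum.elim lam x) (formLam v) = v ⬝ᵥ lam := by
  simp [formLam, dotProduct]

lemma hasDerivAt_eval_line (v lam x : Fin N → ℂ) (p : MvPolynomial (Fin N ⊕ Fin N) ℂ) (t : ℂ) :
    HasDerivAt (fun t : ℂ => eval (Sum.elim lam (x + t • v)) p)
      (eval (Sum.elim lam (x + t • v)) (dirDeriv v p)) t := by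
  induction p using MvPolynomial.induction_on with
  | C a => simpa [dirDeriv_apply] using hasDerivAt_const t a
  | add p q hp hq => simpa using hp.fun_add hq
  | mul_X p i hp =>
    have hX : HasDerivAt (fun t : ℂ => eval (Sum.elim lam (x + t • v)) (X i))
        (eval (Sum.elim lam (x + t • v)) (dirDeriv v (X i))) t := by
      rcases i with i | i
      · simpa [dirDeriv_apply, pderiv_X, Pi.single_apply] using hasDerivAt_const t (lam i)
      · have : dirDeriv v (X (Sum.inr i)) = C (v i) := by
          rw [dirDeriv_apply, Finset.sum_eq_single i]
          · simp [smul_eq_C_mul]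
          · intro b _ hb
            simp [pderiv_X, hb.symm]
          · simp
        rw [this]
        simpa using ((hasDerivAt_id t).mul_const (v i)).const_add (x i)
    simp only [map_mul, Derivation.leibniz, smul_eq_mul, map_add]
    refine (hp.fun_mul hX).congr_deriv ?_
    ring

lemma hasDerivAt_eval_mul_exp_line (v lam x : Fin N → ℂ) (p : MvPolynomial (Fin N ⊕ Fin N) ℂ)
    (t : ℂ) :
    HasDerivAt
      (fun t : ℂ => eval (Sum.elim lam (x + t • v)) p * Complex.exp (lam ⬝ᵥ (x + t • v)))
      (eval (Sum.elim lam (x + t • v)) (twistedDeriv v p) * Complex.exp (lam ⬝ᵥ (x + t • v))) t := by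
  have h1 : HasDerivAt (fun t : ℂ => lam ⬝ᵥ (x + t • v)) (lam ⬝ᵥ v) t := by
    simp only [dotProduct_add, dotProduct_smul, smul_eq_mul]
    simpa using ((hasDerivAt_id t).mul_const (lam ⬝ᵥ v)).const_add (lam ⬝ᵥ x)
  refine ((hasDerivAt_eval_line v lam x p t).fun_mul h1.cexp).congr_deriv ?_
  rw [twistedDeriv_apply, map_add, map_mul, eval_formLam, dotProduct_comm v lam]
  ring

lemma iteratedDeriv_eval_mul_exp_line (v lam x : Fin N → ℂ) (k : ℕ) :
    ∀ p : MvPolynomial (Fin N ⊕ Fin N) ℂ, iteratedDeriv k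
      (fun t : ℂ => eval (Sum.elim lam (x + t • v)) p * Complex.exp (lam ⬝ᵥ (x + t • v))) =
    fun t : ℂ => eval (Sum.elim lam (x + t • v)) ((twistedDeriv v ^ k) p) *
      Complex.exp (lam ⬝ᵥ (x + t • v)) := by
  induction k with
  | zero => intro p; simp
  | succ k ih =>
    intro p
    rw [iteratedDeriv_succ', pow_succ, Module.End.mul_apply, ← ih]
    congr 1
    funext t
    exact (hasDerivAt_eval_mul_exp_line v lam x p t).deriv

/-- Divisibility form of the vanishing of the odd normal derivatives. -/
def IsQuasiInvariant {ι : Type*} (α : ι → Fin N → ℂ) (m : ι → ℕ)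
    (p : MvPolynomial (Fin N ⊕ Fin N) ℂ) : Prop :=
  ∀ i r, 1 ≤ r → r ≤ m i → formX (α i) ∣ (twistedDeriv (α i) ^ (2 * r - 1)) p

lemma IsQuasiInvariant.iteratedDeriv_eq_zero {ι : Type*} {α : ι → Fin N → ℂ} {m : ι → ℕ}
    {p : MvPolynomial (Fin N ⊕ Fin N) ℂ} (hp : IsQuasiInvariant α m p) (i : ι) (r : ℕ)
    (h1 : 1 ≤ r) (h2 : r ≤ m i) (lam x : Fin N → ℂ) (hx : α i ⬝ᵥ x = 0) :
    iteratedDeriv (2 * r - 1) (fun t : ℂ => eval (Sum.elim lam (x + t • α i)) p *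
      Complex.exp (lam ⬝ᵥ (x + t • α i))) 0 = 0 := by
  rw [iteratedDeriv_eval_mul_exp_line]
  obtain ⟨g, hg⟩ := hp i r h1 h2
  simp [hg, eval_formX, hx]

/-- Each differentiation costs at most one factor of the form, and at most `2 * m i - 1` of them are
taken, so one factor remains. This supplies the starting point δ² of the iteration. -/
lemma IsQuasiInvariant.of_pow_dvd {ι : Type*} {α : ι → Fin N → ℂ} {m : ι → ℕ}
    {p : MvPolynomial (Fin N ⊕ Fin N) ℂ} (hp : ∀ i, formX (α i) ^ (2 * m i) ∣ p) :
    IsQuasiInvariant α m p := by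
  intro i r h1 h2
  have := pow_dvd_twistedDeriv_pow (α i) (formX (α i)) (2 * r - 1) 1 p
    ((pow_dvd_pow _ (by omega)).trans (hp i))
  simpa using this

lemma IsQuasiInvariant.smul {ι : Type*} {α : ι → Fin N → ℂ} {m : ι → ℕ}
    {p : MvPolynomial (Fin N ⊕ Fin N) ℂ} (hp : IsQuasiInvariant α m p) (c : ℂ) :
    IsQuasiInvariant α m (c • p) := by
  intro i r h1 h2
  rw [map_smul, smul_eq_C_mul]
  exact (hp i r h1 h2).mul_left _

end Twisted

/-! ### Linear forms as prime elements -/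

section Forms

variable {N : ℕ}

lemma isHomogeneous_formX (v : Fin N → ℂ) : (formX v).IsHomogeneous 1 :=
  IsHomogeneous.sum _ _ _ fun k _ => by
    simpa using (isHomogeneous_C _ (v k)).mul (isHomogeneous_X ℂ (Sum.inr k))

lemma isHomogeneous_formLam (v : Fin N → ℂ) : (formLam v).IsHomogeneous 1 :=
  IsHomogeneous.sum _ _ _ fun k _ => by
    simpa using (isHomogeneous_C _ (v k)).mul (isHomogeneous_X ℂ (Sum.inl k))

lemma formX_ne_zero {v : Fin N → ℂ} (hv : v ⬝ᵥ v ≠ 0) : formX v ≠ 0 := by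
  intro h
  apply hv
  have := eval_formX v 0 v
  rw [h] at this
  simpa using this.symm

/-- A polynomial of degree one over a field is irreducible, hence prime by unique factorization.
Primality allows the factor (α^⊥,x) to be cancelled modulo (α,x). -/
lemma prime_formX {v : Fin N → ℂ} (hv : v ⬝ᵥ v ≠ 0) : Prime (formX v) := by
  have h0 := formX_ne_zero hv
  have h1 := (isHomogeneous_formX v).totalDegree h0
  refine (irreducible_of_totalDegree_eq_one h1 fun x hx => ?_).prime
  rw [isUnit_iff_ne_zero]
  rintro rfl
  exact h0 (MvPolynomial.ext _ _ fun d => by simpa using hx d)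

lemma not_formX_dvd_formX {v w : Fin N → ℂ} (hvw : v ⬝ᵥ w = 0) (hw : w ⬝ᵥ w ≠ 0) :
    ¬ formX v ∣ formX w := by
  rintro ⟨r, hr⟩
  apply hw
  rw [← eval_formX w 0 w, hr, map_mul, eval_formX, hvw, zero_mul]

end Forms

/-! ### The gauged Calogero-Moser operator preserves quasi-invariants -/

section Preservation

/-- Rotation by a right angle. -/
def perp (v : Fin 2 → ℂ) : Fin 2 → ℂ := ![-v 1, v 0]

lemma dotProduct_perp (v : Fin 2 → ℂ) : v ⬝ᵥ perp v = 0 := by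
  simp [perp, dotProduct, Fin.sum_univ_two]; ring

lemma perp_dotProduct_perp (v : Fin 2 → ℂ) : perp v ⬝ᵥ perp v = v ⬝ᵥ v := by
  simp [perp, dotProduct, Fin.sum_univ_two]; ring

lemma eq_smul_add_smul_perp {v : Fin 2 → ℂ} (hv : v ⬝ᵥ v = 1) (w : Fin 2 → ℂ) :
    w = (v ⬝ᵥ w) • v + (perp v ⬝ᵥ w) • perp v := by
  simp only [dotProduct, Fin.sum_univ_two] at hv
  ext k
  fin_cases k <;> simp [perp, dotProduct, Fin.sum_univ_two]
  · linear_combination (-w 0) * hv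
  · linear_combination (-w 1) * hv

/-- The cotangent of the angle from `v` to `w`. -/
def cotBetween (v w : Fin 2 → ℂ) : ℂ := (v ⬝ᵥ w) / (perp v ⬝ᵥ w)

variable {ι : Type*} [Fintype ι] [DecidableEq ι]

/-- The locus equations of a planar configuration of unit vectors. -/
def LocusEquations (α : ι → Fin 2 → ℂ) (m : ι → ℕ) : Prop :=
  ∀ i r, 1 ≤ r → r ≤ m i →
    ∑ j ∈ Finset.univ.erase i, (m j : ℂ) * cotBetween (α i) (α j) ^ (2 * r - 1) = 0

variable {α : ι → Fin 2 → ℂ} {m : ι → ℕ}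

/-- In the frame (v, v^⊥) write w = cv + dv^⊥, differentiate `hr` k times along v and divide by d.
Only the cotangent c/d is left, so the relations for different w can be combined with weights that
are powers of it. -/
lemma normalized_quotient_relation {v w : Fin 2 → ℂ} (hv : v ⬝ᵥ v = 1)
    (hvw : perp v ⬝ᵥ w ≠ 0) {p r : MvPolynomial (Fin 2 ⊕ Fin 2) ℂ}
    (hr : formX w * r = twistedDeriv w p) (k : ℕ) :
    C (cotBetween v w) * (formX v * (twistedDeriv v ^ k) r) +
        formX (perp v) * (twistedDeriv v ^ k) r +
        C (k * cotBetween v w) * (twistedDeriv v ^ (k - 1)) r =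
      C (cotBetween v w) * (twistedDeriv v ^ (k + 1)) p +
        twistedDeriv (perp v) ((twistedDeriv v ^ k) p) := by
  have h := congrArg (twistedDeriv v ^ k) hr
  rw [twistedDeriv_pow_formX_mul] at h
  obtain ⟨c, hc⟩ : ∃ c, c = v ⬝ᵥ w := ⟨_, rfl⟩
  obtain ⟨d, hd⟩ : ∃ d, d = perp v ⬝ᵥ w := ⟨_, rfl⟩
  have hw := eq_smul_add_smul_perp hv w
  rw [← hc, ← hd] at hw
  rw [← hc] at h
  have e1 : formX w = c • formX v + d • formX (perp v) := by rw [← formX_comb, ← hw]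
  have e2 : twistedDeriv w p = c • twistedDeriv v p + d • twistedDeriv (perp v) p := by
    rw [← twistedDeriv_comb, ← hw]
  have e3 : (twistedDeriv v ^ k) (twistedDeriv (perp v) p) =
      twistedDeriv (perp v) ((twistedDeriv v ^ k) p) := by
    have := ((twistedDeriv_comm v (perp v)).pow_left k).eq
    exact DFunLike.congr_fun this p
  rw [e1, e2, map_add, map_smul, map_smul, e3, ← Module.End.mul_apply, ← pow_succ] at h
  simp only [smul_eq_C_mul] at h
  have hd0 : d ≠ 0 := hd ▸ hvw
  have hk : C (cotBetween v w) = C c * (C d⁻¹ : MvPolynomial (Fin 2 ⊕ Fin 2) ℂ) := by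
    rw [← C_mul, cotBetween, hc, hd, div_eq_mul_inv]
  have hdd : (C d : MvPolynomial (Fin 2 ⊕ Fin 2) ℂ) * C d⁻¹ = 1 := by
    rw [← C_mul, mul_inv_cancel₀ hd0, C_1]
  rw [C_mul, hk]
  linear_combination (C d⁻¹) * h + (twistedDeriv (perp v) ((twistedDeriv v ^ k) p) -
    formX (perp v) * (twistedDeriv v ^ k) r) * hdd

/-- Weighted sums of the odd derivatives of the quotients vanish on the line. -/
lemma formX_dvd_weighted_sum (hunit : ∀ i, α i ⬝ᵥ α i = 1)
    (hdet : Pairwise fun i j => perp (α i) ⬝ᵥ α j ≠ 0) (hloc : LocusEquations α m)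
    {p : MvPolynomial (Fin 2 ⊕ Fin 2) ℂ} (hp : IsQuasiInvariant α m p)
    {r : ι → MvPolynomial (Fin 2 ⊕ Fin 2) ℂ}
    (hr : ∀ j, m j ≠ 0 → formX (α j) * r j = twistedDeriv (α j) p) (i : ι) (k : ℕ) :
    ∀ a : ℕ, Odd (a + k) → a + k ≤ 2 * m i - 1 →
      formX (α i) ∣ ∑ j ∈ Finset.univ.erase i,
        C ((m j : ℂ) * cotBetween (α i) (α j) ^ a) * (twistedDeriv (α i) ^ k) (r j) := by
  -- The normalized relations for all j ≠ i, weighted by mⱼ cot^a and added. Modulo (αᵢ,x) this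
  -- expresses the sum for (k, a) through the one for (k - 1, a + 1), with the same a + k, plus
  -- derivatives of p multiplied by cotangent moments.
  have key : ∀ k a : ℕ,
      formX (α i) * (∑ j ∈ Finset.univ.erase i,
        C ((m j : ℂ) * cotBetween (α i) (α j) ^ (a + 1)) * (twistedDeriv (α i) ^ k) (r j)) +
      formX (perp (α i)) * (∑ j ∈ Finset.univ.erase i,
        C ((m j : ℂ) * cotBetween (α i) (α j) ^ a) * (twistedDeriv (α i) ^ k) (r j)) +
      C (k : ℂ) * (∑ j ∈ Finset.univ.erase i,
        C ((m j : ℂ) * cotBetween (α i) (α j) ^ (a + 1)) * (twistedDeriv (α i) ^ (k - 1)) (r j)) =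
      C (∑ j ∈ Finset.univ.erase i, (m j : ℂ) * cotBetween (α i) (α j) ^ (a + 1)) *
        (twistedDeriv (α i) ^ (k + 1)) p +
      C (∑ j ∈ Finset.univ.erase i, (m j : ℂ) * cotBetween (α i) (α j) ^ a) *
        twistedDeriv (perp (α i)) ((twistedDeriv (α i) ^ k) p) := by
    intro k a
    simp only [map_sum, Finset.mul_sum, Finset.sum_mul, ← Finset.sum_add_distrib]
    refine Finset.sum_congr rfl fun j hj => ?_
    by_cases hm : m j = 0
    · simp [hm]
    have := normalized_quotient_relation (hunit i) (hdet (Finset.ne_of_mem_erase hj).symm)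
      (hr j hm) k
    simp only [C_mul, C_pow, pow_succ] at this ⊢
    linear_combination (C (m j : ℂ) * C (cotBetween (α i) (α j)) ^ a) * this
  have hM : ∀ b, Odd b → b ≤ 2 * m i - 1 →
      ∑ j ∈ Finset.univ.erase i, (m j : ℂ) * cotBetween (α i) (α j) ^ b = 0 := by
    rintro b ⟨l, rfl⟩ hb
    have := hloc i (l + 1) (by omega) (by omega)
    rwa [show 2 * (l + 1) - 1 = 2 * l + 1 by omega] at this
  have hP : ∀ b, Odd b → b ≤ 2 * m i - 1 →
      formX (α i) ∣ (twistedDeriv (α i) ^ b) p := by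
    rintro b ⟨l, rfl⟩ hb
    have := hp i (l + 1) (by omega) (by omega)
    rwa [show 2 * (l + 1) - 1 = 2 * l + 1 by omega] at this
  have hunit' : α i ⬝ᵥ α i ≠ 0 := by simp [hunit]
  have hcancel : ∀ f, formX (α i) ∣ formX (perp (α i)) * f → formX (α i) ∣ f := fun f hf =>
    ((prime_formX hunit').dvd_or_dvd hf).resolve_left
      (not_formX_dvd_formX (dotProduct_perp _) (by rwa [perp_dotProduct_perp]))
  induction k with
  | zero =>
    intro a ha hle
    have h := key 0 a
    rw [hM a ha (by omega)] at h
    apply hcancel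
    simp only [Nat.cast_zero, map_zero, zero_mul, add_zero] at h
    rw [← dvd_add_right (dvd_mul_right _ _), h]
    exact (hP 1 odd_one (by have := ha.pos; omega)).mul_left _
  | succ k ih =>
    intro a ha hle
    have h := key (k + 1) a
    apply hcancel
    rw [← dvd_add_right (dvd_mul_right _ _),
      ← dvd_add_left ((ih (a + 1) (by convert ha using 1; ring) (by omega)).mul_left _)]
    rw [Nat.add_sub_cancel] at h
    rw [h]
    -- Since a + (k + 1) is odd, each of the two terms on the right vanishes modulo (αᵢ,x): the
    -- moment with odd exponent is zero by the locus equations, and the moment with even exponent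
    -- multiplies an odd derivative of p.
    have hpar := Nat.odd_add.1 ha
    rcases Nat.even_or_odd (k + 1) with hk | hk
    · have hao := hpar.2 hk
      rw [hM a hao (by omega), C_0, zero_mul, add_zero]
      exact (hP _ hk.add_one (by have := hao.pos; omega)).mul_left _
    · have hae : Even a := by
        rw [← Nat.not_odd_iff_even]
        exact fun h' => (Nat.not_even_iff_odd.2 hk) (hpar.1 h')
      rw [hM (a + 1) hae.add_one (by have := hk.pos; omega), C_0, zero_mul, zero_add]
      refine (dvd_twistedDeriv_of_dvd ?_ (hP _ hk (by omega))).mul_left _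
      rw [dotProduct_comm, dotProduct_perp]

lemma twistedDeriv_sq_add_sq {v : Fin 2 → ℂ} (hv : v ⬝ᵥ v = 1)
    (p : MvPolynomial (Fin 2 ⊕ Fin 2) ℂ) :
    ∑ k, (twistedDeriv (Pi.single k 1) ^ 2) p =
      (twistedDeriv v ^ 2) p + (twistedDeriv (perp v) ^ 2) p := by
  have e1 : v = v 0 • Pi.single 0 1 + v 1 • Pi.single 1 1 := by
    ext k; fin_cases k <;> simp
  have e2 : perp v = (-v 1) • Pi.single 0 1 + v 0 • Pi.single 1 1 := by
    ext k; fin_cases k <;> simp [perp]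
  have t1 : ∀ q, twistedDeriv v q =
      v 0 • twistedDeriv (Pi.single 0 1) q + v 1 • twistedDeriv (Pi.single 1 1) q := by
    intro q
    rw [← twistedDeriv_comb, ← e1]
  have t2 : ∀ q, twistedDeriv (perp v) q =
      (-v 1) • twistedDeriv (Pi.single 0 1) q + v 0 • twistedDeriv (Pi.single 1 1) q := by
    intro q
    rw [← twistedDeriv_comb, ← e2]
  have hc : twistedDeriv (Pi.single 0 1 : Fin 2 → ℂ) (twistedDeriv (Pi.single 1 1) p) =
      twistedDeriv (Pi.single 1 1) (twistedDeriv (Pi.single 0 1) p) :=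
    twistedDeriv_comm_apply _ _ p
  have hv' : (C (v 0) * C (v 0) + C (v 1) * C (v 1) : MvPolynomial (Fin 2 ⊕ Fin 2) ℂ) = 1 := by
    rw [← C_mul, ← C_mul, ← C_add, ← C_1, ← hv]
    simp [dotProduct, Fin.sum_univ_two]
  simp only [Fin.sum_univ_two, pow_two, Module.End.mul_apply, t1, t2, map_add, map_smul, hc]
  simp only [smul_eq_C_mul, C_neg]
  linear_combination (-(twistedDeriv (Pi.single 0 1)) ((twistedDeriv (Pi.single 0 1)) p) -
    (twistedDeriv (Pi.single 1 1)) ((twistedDeriv (Pi.single 1 1)) p)) * hv'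

/-- `(λ, λ)` as a polynomial. -/
def lamSq : MvPolynomial (Fin 2 ⊕ Fin 2) ℂ := ∑ k, X (Sum.inl k) ^ 2

lemma dirDeriv_lamSq (v : Fin 2 → ℂ) : dirDeriv v lamSq = 0 := by
  simp [dirDeriv_apply, lamSq, pderiv_X]

/-- `L - λ²` applied to a quasi-invariant `p` with quotients `r j = ∂_{α j} p / (α j, x)`. -/
lemma IsQuasiInvariant.gaugedLaplacian (hunit : ∀ i, α i ⬝ᵥ α i = 1)
    (hdet : Pairwise fun i j => perp (α i) ⬝ᵥ α j ≠ 0) (hloc : LocusEquations α m)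
    {p : MvPolynomial (Fin 2 ⊕ Fin 2) ℂ} (hp : IsQuasiInvariant α m p)
    {r : ι → MvPolynomial (Fin 2 ⊕ Fin 2) ℂ}
    (hr : ∀ j, m j ≠ 0 → formX (α j) * r j = twistedDeriv (α j) p) :
    IsQuasiInvariant α m (∑ k, (twistedDeriv (Pi.single k 1) ^ 2) p -
      2 * ∑ j, C (m j : ℂ) * r j - lamSq * p) := by
  intro i l h1 h2
  obtain ⟨k, hk⟩ : ∃ k, k = 2 * l - 1 := ⟨_, rfl⟩
  have hodd : Odd k := ⟨l - 1, by omega⟩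
  rw [← hk]
  have hP : formX (α i) ∣ (twistedDeriv (α i) ^ k) p := hk ▸ hp i l h1 h2
  have hS := formX_dvd_weighted_sum hunit hdet hloc hp hr i k 0 (by simpa using hodd) (by omega)
  simp only [pow_zero, mul_one] at hS
  have hlap : (twistedDeriv (α i) ^ k) (∑ k, (twistedDeriv (Pi.single k 1) ^ 2) p) =
      (twistedDeriv (α i) ^ (k + 2)) p +
        (twistedDeriv (perp (α i)) ^ 2) ((twistedDeriv (α i) ^ k) p) := by
    rw [twistedDeriv_sq_add_sq (hunit i), map_add]
    congr 1
    exact DFunLike.congr_fun (((twistedDeriv_comm (α i) (perp (α i))).pow_pow k 2).eq) p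
  have hC : ∀ (c : ℂ) q, (twistedDeriv (α i) ^ k) (C c * q) =
      C c * (twistedDeriv (α i) ^ k) q := fun c q => by
    rw [← smul_eq_C_mul, map_smul, smul_eq_C_mul]
  have h2C : (2 : MvPolynomial (Fin 2 ⊕ Fin 2) ℂ) = C 2 := (map_ofNat C 2).symm
  rw [map_sub, map_sub, twistedDeriv_pow_mul_of_dirDeriv_eq_zero _ (dirDeriv_lamSq _), hlap, h2C,
    hC, map_sum, ← Finset.add_sum_erase _ _ (Finset.mem_univ i)]
  simp only [hC]
  have hperp : ∀ f, formX (α i) ∣ f → formX (α i) ∣ twistedDeriv (perp (α i)) f := fun f =>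
    dvd_twistedDeriv_of_dvd (by rw [dotProduct_comm, dotProduct_perp])
  have hT : formX (α i) ∣ (twistedDeriv (perp (α i)) ^ 2) ((twistedDeriv (α i) ^ k) p) := by
    rw [pow_two, Module.End.mul_apply]
    exact hperp _ (hperp _ hP)
  have hself : formX (α i) ∣ (twistedDeriv (α i) ^ (k + 2)) p -
      C 2 * (C (m i : ℂ) * (twistedDeriv (α i) ^ k) (r i)) := by
    have h := congrArg (twistedDeriv (α i) ^ (k + 1)) (hr i (by omega))
    rw [twistedDeriv_pow_formX_mul, ← Module.End.mul_apply _ (twistedDeriv (α i)), ← pow_succ,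
      hunit, Nat.add_sub_cancel, one_smul, smul_eq_C_mul] at h
    -- At the last order k + 1 = 2mᵢ, and the singular term of the operator cancels ∂^{k+2}p
    -- exactly. At lower orders ∂^{k+2}p is itself divisible, and then so is ∂^k rᵢ because k + 1 ≠
    -- 0.
    rcases h2.eq_or_lt with hl | hl
    · have : C ((k + 1 : ℕ) : ℂ) =
          (C 2 * C (m i : ℂ) : MvPolynomial (Fin 2 ⊕ Fin 2) ℂ) := by
        rw [← C_mul, show k + 1 = 2 * m i by omega]
        push_cast; rfl
      rw [this] at h
      exact ⟨(twistedDeriv (α i) ^ (k + 1)) (r i), by linear_combination -h⟩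
    · have h3 : formX (α i) ∣ (twistedDeriv (α i) ^ (k + 2)) p := by
        have := hp i (l + 1) (by omega) (by omega)
        rwa [show 2 * (l + 1) - 1 = k + 2 by omega] at this
      have h4 : formX (α i) ∣ C ((k + 1 : ℕ) : ℂ) * (twistedDeriv (α i) ^ k) (r i) := by
        rw [← dvd_add_right (dvd_mul_right _ _), h]
        exact h3
      have h5 : IsUnit (C ((k + 1 : ℕ) : ℂ) : MvPolynomial (Fin 2 ⊕ Fin 2) ℂ) :=
        (isUnit_iff_ne_zero.2 (Nat.cast_ne_zero.2 (by omega))).map C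
      exact dvd_sub h3 (((h5.dvd_mul_left).1 h4).mul_left _ |>.mul_left _)
  have : formX (α i) ∣ ((twistedDeriv (α i) ^ (k + 2)) p -
      C 2 * (C (m i : ℂ) * (twistedDeriv (α i) ^ k) (r i))) +
      (twistedDeriv (perp (α i)) ^ 2) ((twistedDeriv (α i) ^ k) p) -
      C 2 * (∑ j ∈ Finset.univ.erase i, C (m j : ℂ) * (twistedDeriv (α i) ^ k) (r j)) -
      lamSq * (twistedDeriv (α i) ^ k) p :=
    dvd_sub (dvd_sub (dvd_add hself hT) (hS.mul_left _)) (hP.mul_left _)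
  convert this using 1
  ring

end Preservation

/-! ### Degree bounds -/

section Degree

lemma totalDegree_pderiv_le {σ : Type*} (i : σ) (p : MvPolynomial σ ℂ) :
    (pderiv i p).totalDegree ≤ p.totalDegree - 1 := by
  rw [p.as_sum, map_sum, ← p.as_sum]
  refine totalDegree_finsetSum_le fun d hd => ?_
  rw [pderiv_monomial]
  by_cases h0 : d i = 0
  · simp [h0]
  refine (totalDegree_monomial_le _ _).trans ?_
  have h1 := le_totalDegree hd
  have h2 : d = (d - Finsupp.single i 1) + Finsupp.single i 1 := by
    ext j
    by_cases hj : i = j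
    · subst hj; simp; omega
    · simp [hj]
  rw [h2, Finsupp.sum_add_index' (by simp) (by simp)] at h1
  simp only [Finsupp.sum_single_index] at h1
  simp only [Finsupp.sum, id] at h1 ⊢
  omega

variable {N : ℕ}

/-- The derivation `(λ, ∂ₓ)`. -/
def lamDeriv :
    Derivation ℂ (MvPolynomial (Fin N ⊕ Fin N) ℂ) (MvPolynomial (Fin N ⊕ Fin N) ℂ) :=
  ∑ k, (X (Sum.inl k) : MvPolynomial (Fin N ⊕ Fin N) ℂ) • pderiv (Sum.inr k)

lemma lamDeriv_apply (p : MvPolynomial (Fin N ⊕ Fin N) ℂ) :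
    lamDeriv p = ∑ k, X (Sum.inl k) * pderiv (Sum.inr k) p := by
  simp only [lamDeriv, ← Derivation.coeFnAddMonoidHom_apply, map_sum, Finset.sum_apply]
  simp

lemma lamDeriv_formX (v : Fin N → ℂ) : lamDeriv (formX v) = formLam v := by
  simp only [lamDeriv_apply, formX, map_sum, formLam]
  refine Finset.sum_congr rfl fun k _ => ?_
  rw [Finset.sum_eq_single k]
  · simp [mul_comm]
  · intro b _ hb
    simp [pderiv_X, hb]
  · simp

lemma lamDeriv_formLam (v : Fin N → ℂ) : lamDeriv (formLam v) = 0 := by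
  simp [lamDeriv_apply, formLam, pderiv_X]

lemma totalDegree_formLam_le (v : Fin N → ℂ) : (formLam v).totalDegree ≤ 1 :=
  (isHomogeneous_formLam v).totalDegree_le

lemma totalDegree_dirDeriv_le (v : Fin N → ℂ) (p : MvPolynomial (Fin N ⊕ Fin N) ℂ) :
    (dirDeriv v p).totalDegree ≤ p.totalDegree - 1 := by
  rw [dirDeriv_apply]
  exact totalDegree_finsetSum_le fun k _ =>
    (totalDegree_smul_le _ _).trans (totalDegree_pderiv_le _ _)

lemma totalDegree_lamDeriv_le (p : MvPolynomial (Fin N ⊕ Fin N) ℂ) :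
    (lamDeriv p).totalDegree ≤ p.totalDegree := by
  rw [lamDeriv_apply]
  refine totalDegree_finsetSum_le fun k _ => ?_
  rcases Nat.eq_zero_or_pos p.totalDegree with h | h
  · rw [totalDegree_eq_zero_iff_eq_C.1 h]
    simp
  · refine (totalDegree_mul _ _).trans ?_
    have := totalDegree_pderiv_le (Sum.inr k) p
    rw [totalDegree_X]
    omega

lemma totalDegree_lamDeriv_iterate_le (p : MvPolynomial (Fin N ⊕ Fin N) ℂ) (k : ℕ) :
    (lamDeriv^[k] p).totalDegree ≤ p.totalDegree := by
  induction k with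
  | zero => simp
  | succ k ih =>
    rw [Function.iterate_succ_apply']
    exact (totalDegree_lamDeriv_le _).trans ih

lemma derivation_finset_prod {R A ι : Type*} [CommSemiring R] [CommSemiring A] [Algebra R A]
    [DecidableEq ι] (D : Derivation R A A) (s : Finset ι) (f : ι → A) :
    D (∏ i ∈ s, f i) = ∑ i ∈ s, (∏ j ∈ s.erase i, f j) * D (f i) := by
  induction s using Finset.induction_on with
  | empty => simp
  | insert a s ha ih =>
    rw [Finset.prod_insert ha, Derivation.leibniz, ih, Finset.sum_insert ha,
      Finset.erase_insert ha, add_comm, smul_eq_mul, smul_eq_mul, Finset.mul_sum]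
    congr 1
    refine Finset.sum_congr rfl fun i hi => ?_
    rw [Finset.erase_insert_of_ne (by rintro rfl; exact ha hi),
      Finset.prod_insert (by simp [ha])]
    ring

lemma lamDeriv_iterate_formX_mul (v : Fin N → ℂ) (f : MvPolynomial (Fin N ⊕ Fin N) ℂ) (k : ℕ) :
    lamDeriv^[k + 1] (formX v * f) =
      formX v * lamDeriv^[k + 1] f + (k + 1 : ℕ) * (formLam v * lamDeriv^[k] f) := by
  induction k with
  | zero => simp [lamDeriv_formX]; ring
  | succ k ih =>
    rw [Function.iterate_succ_apply', ih]
    simp only [map_add, Derivation.leibniz, lamDeriv_formX, lamDeriv_formLam, smul_eq_mul,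
      Derivation.map_natCast, ← Function.iterate_succ_apply' (f := lamDeriv)]
    push_cast
    ring

/-- `(λ, ∂ₓ)^d f = d! g` with `g` depending on `λ` only. -/
def IsPolarization (d : ℕ) (f g : MvPolynomial (Fin N ⊕ Fin N) ℂ) : Prop :=
  lamDeriv^[d] f = (d.factorial : MvPolynomial (Fin N ⊕ Fin N) ℂ) * g ∧ lamDeriv g = 0

/-- By Leibniz, (λ,∂ₓ)^{d+1} of the product is (v,x)(λ,∂ₓ)^{d+1}f + (d+1)(v,λ)(λ,∂ₓ)^d f. The first
term vanishes since g is killed by (λ,∂ₓ), and d + 1 completes the factorial. -/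
lemma IsPolarization.form_mul {d : ℕ} {f g : MvPolynomial (Fin N ⊕ Fin N) ℂ}
    (h : IsPolarization d f g) (v : Fin N → ℂ) :
    IsPolarization (d + 1) (formX v * f) (formLam v * g) := by
  constructor
  · rw [lamDeriv_iterate_formX_mul, Function.iterate_succ_apply', h.1]
    simp only [Derivation.leibniz, h.2, Derivation.map_natCast, Nat.factorial_succ]
    push_cast
    simp
    ring
  · simp [lamDeriv_formLam, h.2]

lemma IsPolarization.form_pow_mul {d : ℕ} {f g : MvPolynomial (Fin N ⊕ Fin N) ℂ}
    (h : IsPolarization d f g) (v : Fin N → ℂ) (k : ℕ) :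
    IsPolarization (k + d) (formX v ^ k * f) (formLam v ^ k * g) := by
  induction k with
  | zero => simpa using h
  | succ k ih =>
    rw [pow_succ', pow_succ', mul_assoc, mul_assoc, show k + 1 + d = k + d + 1 by ring]
    exact ih.form_mul v

lemma isPolarization_prod {ι : Type*} (s : Finset ι) (α : ι → Fin N → ℂ) (m : ι → ℕ) :
    IsPolarization (∑ i ∈ s, m i) (∏ i ∈ s, formX (α i) ^ m i) (∏ i ∈ s, formLam (α i) ^ m i) := by
  classical
  induction s using Finset.induction_on with
  | empty => simp [IsPolarization]
  | insert a s ha ih =>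
    rw [Finset.sum_insert ha, Finset.prod_insert ha, Finset.prod_insert ha]
    exact ih.form_pow_mul _ _

lemma isHomogeneous_prod_formX {ι : Type*} (s : Finset ι) (α : ι → Fin N → ℂ) (m : ι → ℕ) :
    (∏ i ∈ s, formX (α i) ^ m i).IsHomogeneous (∑ i ∈ s, m i) :=
  IsHomogeneous.prod _ _ _ fun i _ => by simpa using (isHomogeneous_formX (α i)).pow (m i)

lemma isHomogeneous_prod_formLam {ι : Type*} (s : Finset ι) (α : ι → Fin N → ℂ) (m : ι → ℕ) :
    (∏ i ∈ s, formLam (α i) ^ m i).IsHomogeneous (∑ i ∈ s, m i) :=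
  IsHomogeneous.prod _ _ _ fun i _ => by simpa using (isHomogeneous_formLam (α i)).pow (m i)

/-- Subtracting (λ,λ) removes the only part that raises the degree: Δ lowers it by two and 2(λ,∂ₓ)
does not increase it. -/
lemma sum_twistedDeriv_single_sq (p : MvPolynomial (Fin 2 ⊕ Fin 2) ℂ) :
    ∑ k, (twistedDeriv (Pi.single k 1) ^ 2) p - lamSq * p =
      ∑ k : Fin 2, dirDeriv (Pi.single k 1) (dirDeriv (Pi.single k 1) p) + 2 * lamDeriv p := by
  have h1 : ∀ k : Fin 2, formLam (Pi.single k 1) = X (Sum.inl k) := by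
    intro k; fin_cases k <;> simp [formLam]
  have h2 : ∀ k : Fin 2, pderiv (Sum.inr k) p = dirDeriv (Pi.single k 1) p := by
    intro k; fin_cases k <;> simp [dirDeriv_apply]
  have h3 : ∀ (k : Fin 2) (v : Fin 2 → ℂ), dirDeriv v (X (Sum.inl k)) = 0 := by
    intro k v
    rw [← h1, dirDeriv_formLam]
  simp only [lamDeriv_apply, h2, Fin.sum_univ_two, pow_two, Module.End.mul_apply,
    twistedDeriv_apply, lamSq, h1, map_add, Derivation.leibniz, h3, smul_eq_mul]
  ring

end Degree

/-! ### Berest's formula -/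

section Berest

variable {ι : Type*} [Fintype ι] [DecidableEq ι] {α : ι → Fin 2 → ℂ} {m : ι → ℕ}

/-- The logarithmic derivative of δ along λ, with denominators cleared. -/
lemma prod_formX_mul_lamDeriv_prod (α : ι → Fin 2 → ℂ) (m : ι → ℕ) :
    (∏ i, formX (α i)) * lamDeriv (∏ i, formX (α i) ^ m i) =
      ∑ i, C (m i : ℂ) * ((∏ j ∈ Finset.univ.erase i, formX (α j)) *
        (formLam (α i) * ∏ i, formX (α i) ^ m i)) := by
  rw [derivation_finset_prod, Finset.mul_sum]
  refine Finset.sum_congr rfl fun i _ => ?_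
  rw [← Finset.mul_prod_erase _ (fun i => formX (α i)) (Finset.mem_univ i),
    ← Finset.mul_prod_erase _ (fun i => formX (α i) ^ m i) (Finset.mem_univ i),
    Derivation.leibniz_pow, lamDeriv_formX]
  rcases h : m i with _ | k
  · simp
  · simp only [Nat.add_sub_cancel, nsmul_eq_mul, smul_eq_mul, map_natCast, pow_succ]
    ring

/-- One step of Berest's formula, with control of the leading term. -/
lemma exists_isQuasiInvariant_step (hunit : ∀ i, α i ⬝ᵥ α i = 1)
    (hdet : Pairwise fun i j => perp (α i) ⬝ᵥ α j ≠ 0) (hloc : LocusEquations α m)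
    (hM : 0 < ∑ i, m i) {h low : MvPolynomial (Fin 2 ⊕ Fin 2) ℂ}
    (hh : h.totalDegree ≤ ∑ i, m i) (hlow : low.totalDegree < 2 * ∑ i, m i)
    (hp : IsQuasiInvariant α m ((∏ i, formX (α i) ^ m i) * h + low)) :
    ∃ low' : MvPolynomial (Fin 2 ⊕ Fin 2) ℂ, low'.totalDegree < 2 * ∑ i, m i ∧
      IsQuasiInvariant α m ((∏ i, formX (α i) ^ m i) * (2 * lamDeriv h) + low') := by
  obtain ⟨M, hMdef⟩ : ∃ M, M = ∑ i, m i := ⟨_, rfl⟩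
  obtain ⟨δ, hδ⟩ : ∃ δ, δ = ∏ i, formX (α i) ^ m i := ⟨_, rfl⟩
  obtain ⟨p, hpdef⟩ : ∃ p, p = δ * h + low := ⟨_, rfl⟩
  rw [← hδ, ← hpdef] at hp
  rw [← hMdef] at hM hh hlow ⊢
  rw [← hδ]
  have hδdeg : δ.totalDegree ≤ M := by
    rw [hδ, hMdef]; exact (isHomogeneous_prod_formX _ _ _).totalDegree_le
  have hpdeg : p.totalDegree ≤ 2 * M := by
    rw [hpdef]
    refine (totalDegree_add _ _).trans (max_le ((totalDegree_mul _ _).trans ?_) hlow.le)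
    omega
  have hquot : ∀ j, ∃ r, m j ≠ 0 → formX (α j) * r = twistedDeriv (α j) p := by
    intro j
    by_cases hj : m j = 0
    · exact ⟨0, fun h => absurd hj h⟩
    · obtain ⟨r, hr⟩ := hp j 1 le_rfl (Nat.one_le_iff_ne_zero.2 hj)
      exact ⟨r, fun _ => by simpa using hr.symm⟩
  choose r hr using hquot
  have hg := hp.gaugedLaplacian hunit hdet hloc hr
  obtain ⟨g, hgdef⟩ : ∃ g, g = ∑ k, (twistedDeriv (Pi.single k 1) ^ 2) p -
      2 * ∑ j, C (m j : ℂ) * r j - lamSq * p := ⟨_, rfl⟩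
  rw [← hgdef] at hg
  refine ⟨g - δ * (2 * lamDeriv h), ?_, by simpa using hg⟩
  obtain ⟨π, hπ⟩ : ∃ π, π = ∏ i, formX (α i) := ⟨_, rfl⟩
  have hℓ0 : ∀ i, formX (α i) ≠ 0 := fun i => formX_ne_zero (by simp [hunit])
  have hπ0 : π ≠ 0 := hπ ▸ Finset.prod_ne_zero_iff.2 fun i _ => hℓ0 i
  have hπdeg : π.totalDegree = Fintype.card ι := by
    have := isHomogeneous_prod_formX Finset.univ α (fun _ => 1)
    simp only [pow_one, Finset.sum_const, smul_eq_mul, mul_one, Finset.card_univ, ← hπ] at this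
    exact this.totalDegree hπ0
  have herase : ∀ i, (∏ j ∈ Finset.univ.erase i, formX (α j)).totalDegree ≤ Fintype.card ι - 1 := by
    intro i
    have := isHomogeneous_prod_formX (Finset.univ.erase i) α (fun _ => 1)
    simp only [pow_one, Finset.sum_const, smul_eq_mul, mul_one,
      Finset.card_erase_of_mem (Finset.mem_univ i), Finset.card_univ] at this
    exact this.totalDegree_le
  have hπr : π * ∑ j, C (m j : ℂ) * r j = ∑ j, C (m j : ℂ) *
      ((∏ k ∈ Finset.univ.erase j, formX (α k)) * (dirDeriv (α j) p + formLam (α j) * p)) := by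
    rw [Finset.mul_sum]
    refine Finset.sum_congr rfl fun j _ => ?_
    by_cases hj : m j = 0
    · simp [hj]
    rw [← twistedDeriv_apply, ← hr j hj, hπ,
      ← Finset.mul_prod_erase _ (fun i => formX (α i)) (Finset.mem_univ j)]
    ring
  -- Multiplication by π = ∏ (αᵢ,x) clears the denominators of L. The contributions of δh in degree
  -- `2 * M` then cancel by the logarithmic derivative of δ, and every surviving term either
  -- involves `low` or has lost a degree by differentiation in x.
  have hπg : π * (g - δ * (2 * lamDeriv h)) =
      π * ∑ k : Fin 2, dirDeriv (Pi.single k 1) (dirDeriv (Pi.single k 1) p) +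
      C 2 * (π * lamDeriv low) -
      C 2 * (∑ j, C (m j : ℂ) *
        ((∏ k ∈ Finset.univ.erase j, formX (α k)) * dirDeriv (α j) p)) -
      C 2 * (∑ j, C (m j : ℂ) *
        ((∏ k ∈ Finset.univ.erase j, formX (α k)) * (formLam (α j) * low))) := by
    have e1 := sum_twistedDeriv_single_sq p
    have e2 := prod_formX_mul_lamDeriv_prod α m
    rw [← hπ, ← hδ] at e2
    have e3 : lamDeriv p = lamDeriv δ * h + δ * lamDeriv h + lamDeriv low := by
      rw [hpdef, map_add, Derivation.leibniz]; simp only [smul_eq_mul]; ring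
    have e4 : π * ∑ j, C (m j : ℂ) * r j =
        (∑ j, C (m j : ℂ) * ((∏ k ∈ Finset.univ.erase j, formX (α k)) * dirDeriv (α j) p)) +
        (∑ j, C (m j : ℂ) * ((∏ k ∈ Finset.univ.erase j, formX (α k)) *
          (formLam (α j) * δ))) * h +
        (∑ j, C (m j : ℂ) * ((∏ k ∈ Finset.univ.erase j, formX (α k)) *
          (formLam (α j) * low))) := by
      rw [hπr, Finset.sum_mul, ← Finset.sum_add_distrib, ← Finset.sum_add_distrib]
      refine Finset.sum_congr rfl fun j _ => ?_
      rw [hpdef]; ring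
    rw [← e2] at e4
    have h2C : (C 2 : MvPolynomial (Fin 2 ⊕ Fin 2) ℂ) = 2 := map_ofNat C 2
    rw [hgdef, h2C]
    linear_combination π * e1 + 2 * π * e3 - 2 * e4
  have hC : ∀ (c : ℂ) (f : MvPolynomial (Fin 2 ⊕ Fin 2) ℂ),
      (C c * f).totalDegree ≤ f.totalDegree := fun c f => by
    rw [← smul_eq_C_mul]; exact totalDegree_smul_le _ _
  have hcard : 0 < Fintype.card ι := by
    rw [Fintype.card_pos_iff]
    by_contra hempty
    rw [not_nonempty_iff] at hempty
    simp [hMdef] at hM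
  have hbound : (π * (g - δ * (2 * lamDeriv h))).totalDegree ≤ Fintype.card ι + (2 * M - 1) := by
    rw [hπg]
    refine (totalDegree_sub _ _).trans (max_le ((totalDegree_sub _ _).trans (max_le
      ((totalDegree_add _ _).trans (max_le ?_ ?_)) ?_)) ?_)
    · refine (totalDegree_mul _ _).trans (add_le_add hπdeg.le
        (totalDegree_finsetSum_le fun k _ => ?_))
      refine (totalDegree_dirDeriv_le _ _).trans ?_
      have := totalDegree_dirDeriv_le (Pi.single k 1) p
      omega
    · refine (hC _ _).trans ((totalDegree_mul _ _).trans (add_le_add hπdeg.le ?_))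
      have := totalDegree_lamDeriv_le low
      omega
    · refine (hC _ _).trans (totalDegree_finsetSum_le fun j _ =>
        (hC _ _).trans ((totalDegree_mul _ _).trans ?_))
      have := totalDegree_dirDeriv_le (α j) p
      have := herase j
      omega
    · refine (hC _ _).trans (totalDegree_finsetSum_le fun j _ =>
        (hC _ _).trans ((totalDegree_mul _ _).trans ?_))
      have := totalDegree_mul (formLam (α j)) low
      have := totalDegree_formLam_le (α j)
      have := herase j
      omega
  by_cases hz : g - δ * (2 * lamDeriv h) = 0
  · rw [hz, totalDegree_zero]; omega
  · rw [totalDegree_mul_of_isDomain hπ0 hz, hπdeg] at hbound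
    omega

lemma exists_isQuasiInvariant_iterate (hunit : ∀ i, α i ⬝ᵥ α i = 1)
    (hdet : Pairwise fun i j => perp (α i) ⬝ᵥ α j ≠ 0) (hloc : LocusEquations α m)
    (hM : 0 < ∑ i, m i) (k : ℕ) :
    ∃ low : MvPolynomial (Fin 2 ⊕ Fin 2) ℂ, low.totalDegree < 2 * ∑ i, m i ∧
      IsQuasiInvariant α m ((∏ i, formX (α i) ^ m i) *
        ((2 ^ k : ℂ) • lamDeriv^[k] (∏ i, formX (α i) ^ m i)) + low) := by
  induction k with
  | zero =>
    refine ⟨0, by rw [totalDegree_zero]; omega, IsQuasiInvariant.of_pow_dvd fun i => ?_⟩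
    simp only [pow_zero, one_smul, Function.iterate_zero, id, add_zero]
    rw [two_mul, pow_add]
    have := Finset.dvd_prod_of_mem (fun i => formX (α i) ^ m i) (Finset.mem_univ i)
    exact mul_dvd_mul this this
  | succ k ih =>
    obtain ⟨low, hlow, hq⟩ := ih
    obtain ⟨low', hlow', hq'⟩ := exists_isQuasiInvariant_step hunit hdet hloc hM
      ((totalDegree_smul_le _ _).trans ((totalDegree_lamDeriv_iterate_le _ k).trans
        (isHomogeneous_prod_formX _ α m).totalDegree_le)) hlow hq
    refine ⟨low', hlow', ?_⟩
    convert hq' using 3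
    rw [Function.iterate_succ_apply', Derivation.map_smul, pow_succ, smul_eq_C_mul, smul_eq_C_mul,
      C_mul, show (C 2 : MvPolynomial (Fin 2 ⊕ Fin 2) ℂ) = 2 from map_ofNat C 2]
    ring

/-- A planar configuration of unit vectors satisfying the locus equations admits the
Baker-Akhiezer function. -/
theorem admitsBA_of_locusEquations (hunit : ∀ i, α i ⬝ᵥ α i = 1)
    (hdet : Pairwise fun i j => perp (α i) ⬝ᵥ α j ≠ 0) (hloc : LocusEquations α m) :
    AdmitsBA α m := by
  suffices ∃ P : MvPolynomial (Fin 2 ⊕ Fin 2) ℂ, P.totalDegree ≤ 2 * ∑ i, m i ∧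
      homogeneousComponent (2 * ∑ i, m i) P =
        ∏ i, (formLam (α i) ^ m i * formX (α i) ^ m i) ∧ IsQuasiInvariant α m P by
    obtain ⟨P, h1, h2, h3⟩ := this
    exact ⟨fun lam x => eval (Sum.elim lam x) P * Complex.exp (lam ⬝ᵥ x),
      ⟨P, h1, h2, fun _ _ => rfl⟩, fun i s hs hs' lam x hx =>
        h3.iteratedDeriv_eq_zero i s hs hs' lam x hx⟩
  have htop : (∏ i, (formLam (α i) ^ m i * formX (α i) ^ m i)).IsHomogeneous (2 * ∑ i, m i) := by
    rw [Finset.prod_mul_distrib, two_mul]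
    exact (isHomogeneous_prod_formLam _ _ _).mul (isHomogeneous_prod_formX _ _ _)
  -- The iteration needs a remainder of degree strictly below `2 * ∑ i, m i`, impossible if this is
  -- 0; in that case the empty condition makes the expected top term a solution.
  rcases Nat.eq_zero_or_pos (∑ i, m i) with hM | hM
  · have hm : ∀ i, m i = 0 := fun i => Finset.sum_eq_zero_iff.1 hM i (Finset.mem_univ i)
    refine ⟨∏ i, (formLam (α i) ^ m i * formX (α i) ^ m i), htop.totalDegree_le,
      by rw [homogeneousComponent_of_mem htop, if_pos rfl], fun i r h1 h2 => ?_⟩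
    have := hm i
    omega
  · obtain ⟨low, hlow, hq⟩ := exists_isQuasiInvariant_iterate hunit hdet hloc hM (∑ i, m i)
    rw [(isPolarization_prod Finset.univ α m).1] at hq
    obtain ⟨c, hc⟩ : ∃ c : ℂ, c = 2 ^ (∑ i, m i) * ((∑ i, m i).factorial : ℂ) := ⟨_, rfl⟩
    have hc0 : c ≠ 0 := by
      rw [hc]
      exact mul_ne_zero (pow_ne_zero _ two_ne_zero) (Nat.cast_ne_zero.2 (Nat.factorial_ne_zero _))
    have hform : (∏ i, formX (α i) ^ m i) * ((2 ^ (∑ i, m i) : ℂ) •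
        (((∑ i, m i).factorial : MvPolynomial (Fin 2 ⊕ Fin 2) ℂ) *
          ∏ i, formLam (α i) ^ m i)) + low =
        c • (∏ i, (formLam (α i) ^ m i * formX (α i) ^ m i)) + low := by
      rw [Finset.prod_mul_distrib, hc, smul_eq_C_mul, smul_eq_C_mul, C_mul, map_natCast]
      ring
    rw [hform] at hq
    refine ⟨c⁻¹ • (c • (∏ i, (formLam (α i) ^ m i * formX (α i) ^ m i)) + low),
      (totalDegree_smul_le _ _).trans ((totalDegree_add _ _).trans (max_le
        ((totalDegree_smul_le _ _).trans htop.totalDegree_le) hlow.le)), ?_, hq.smul _⟩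
    rw [map_smul, map_add, map_smul, homogeneousComponent_of_mem htop, if_pos rfl,
      homogeneousComponent_eq_zero _ _ hlow, add_zero, smul_smul, inv_mul_cancel₀ hc0, one_smul]

end Berest

/-! ### Polar angles -/

section Polar

lemma linearIndependent_of_perp_dotProduct_ne_zero {v w : Fin 2 → ℂ} (h : perp v ⬝ᵥ w ≠ 0) :
    LinearIndependent ℂ ![v, w] := by
  rw [LinearIndependent.pair_iff]
  intro s t hst
  have h0 := congrFun hst 0
  have h1 := congrFun hst 1
  simp only [Pi.add_apply, Pi.smul_apply, smul_eq_mul, Pi.zero_apply] at h0 h1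
  simp only [perp, dotProduct, Fin.sum_univ_two, Matrix.cons_val_zero, Matrix.cons_val_one] at h
  exact ⟨(mul_eq_zero.1 (show s * (-v 1 * w 0 + v 0 * w 1) = 0 by
      linear_combination w 1 * h0 - w 0 * h1)).resolve_right h,
    (mul_eq_zero.1 (show t * (-v 1 * w 0 + v 0 * w 1) = 0 by
      linear_combination -v 1 * h0 + v 0 * h1)).resolve_right h⟩

@[simp] lemma polar_zero (a : ℝ) : polar a 0 = Real.cos a := rfl

@[simp] lemma polar_one (a : ℝ) : polar a 1 = Real.sin a := rfl

lemma inner_polar (a b : ℝ) : inner ℝ (polar a) (polar b) = Real.cos (a - b) := by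
  simp [PiLp.inner_apply, Fin.sum_univ_two, Real.cos_sub]; ring

lemma norm_polar (a : ℝ) : ‖polar a‖ = 1 := by
  rw [← sq_eq_sq₀ (norm_nonneg _) zero_le_one, ← real_inner_self_eq_norm_sq, inner_polar]
  simp

lemma polar_ne_zero (a : ℝ) : polar a ≠ 0 := by
  rw [← norm_ne_zero_iff, norm_polar]; exact one_ne_zero

lemma polar_eq_cos_smul_of_sin_eq_zero {a b : ℝ} (h : Real.sin (b - a) = 0) :
    polar b = Real.cos (b - a) • polar a := by
  have e : b = (b - a) + a := by ring
  ext i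
  fin_cases i
  · simp only [Fin.zero_eta, polar_zero, PiLp.smul_apply, smul_eq_mul]
    conv_lhs => rw [e, Real.cos_add, h]
    ring
  · simp only [Fin.mk_one, polar_one, PiLp.smul_apply, smul_eq_mul]
    conv_lhs => rw [e, Real.sin_add, h]
    ring

lemma linearIndependent_polar {a b : ℝ} :
    LinearIndependent ℝ ![polar a, polar b] ↔ Real.sin (b - a) ≠ 0 := by
  rw [LinearIndependent.pair_iff]
  constructor
  · intro h hs
    have := h (Real.cos (b - a)) (-1) (by rw [polar_eq_cos_smul_of_sin_eq_zero hs]; simp)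
    simp at this
  · intro h s t hst
    have h0 := congrArg (fun v : Plane => v 0) hst
    have h1 := congrArg (fun v : Plane => v 1) hst
    simp at h0 h1
    rw [Real.sin_sub] at h
    exact ⟨(mul_eq_zero.1 (show s * (Real.sin b * Real.cos a - Real.cos b * Real.sin a) = 0 by
        linear_combination Real.sin b * h0 - Real.cos b * h1)).resolve_right h,
      (mul_eq_zero.1 (show t * (Real.sin b * Real.cos a - Real.cos b * Real.sin a) = 0 by
        linear_combination -Real.sin a * h0 + Real.cos a * h1)).resolve_right h⟩

lemma sin_sub_eq_zero_iff {a b : ℝ} : Real.sin (a - b) = 0 ↔ ∃ k : ℤ, a = b + k * Real.pi := by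
  rw [Real.sin_eq_zero_iff]
  exact exists_congr fun k => ⟨fun h => by linarith, fun h => by linarith⟩

lemma normalLine_eq_iff {a b : ℝ} :
    normalLine a = normalLine b ↔ ∃ k : ℤ, a = b + k * Real.pi := by
  rw [← sin_sub_eq_zero_iff]
  constructor
  · intro h
    have h' : Submodule.span ℝ {polar a} = Submodule.span ℝ {polar b} := by
      rw [← Submodule.orthogonal_orthogonal (Submodule.span ℝ {polar a}),
        ← Submodule.orthogonal_orthogonal (Submodule.span ℝ {polar b})]
      exact congrArg _ h
    have : polar a ∈ Submodule.span ℝ {polar b} := h' ▸ Submodule.mem_span_singleton_self _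
    obtain ⟨c, hc⟩ := Submodule.mem_span_singleton.1 this
    have h0 := congrArg (fun v : Plane => v 0) hc
    have h1 := congrArg (fun v : Plane => v 1) hc
    simp at h0 h1
    rw [Real.sin_sub, ← h0, ← h1]
    ring
  · intro h
    have h2 : Real.cos (a - b) ≠ 0 := by
      intro h3
      have := Real.sin_sq_add_cos_sq (a - b)
      rw [h, h3] at this
      norm_num at this
    rw [normalLine, normalLine, polar_eq_cos_smul_of_sin_eq_zero h,
      Submodule.span_singleton_smul_eq h2.isUnit]

/-- Reflection in the line is minus the reflection about its normal, which sends the angle b to 2a -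
b; the sign adds π. -/
lemma reflection_normalLine_polar (a b : ℝ) :
    (normalLine a).reflection (polar b) = polar (2 * a + Real.pi - b) := by
  rw [normalLine, Submodule.reflection_orthogonal]
  simp only [LinearIsometryEquiv.trans_apply, LinearIsometryEquiv.coe_neg,
    Submodule.reflection_singleton_apply, inner_polar, norm_polar]
  have e : 2 * a + Real.pi - b = a + (a - b) + Real.pi := by ring
  have eb : b = a - (a - b) := by ring
  ext i
  fin_cases i
  · simp
    rw [e, Real.cos_add_pi, Real.cos_add]
    conv_lhs => rw [eb, Real.cos_sub a (a - b)]
    simp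
    ring
  · simp
    rw [e, Real.sin_add_pi, Real.sin_add]
    conv_lhs => rw [eb, Real.sin_sub a (a - b)]
    simp
    ring

lemma map_normalLine {g : Plane ≃ₗᵢ[ℝ] Plane} {a b : ℝ} (h : g (polar a) = polar b) :
    (normalLine a).map (g.toLinearEquiv : Plane →ₗ[ℝ] Plane) = normalLine b := by
  have := Submodule.map_orthogonal_equiv (Submodule.span ℝ {polar a}) g
  rw [normalLine, normalLine, ← h]
  refine this.trans ?_
  rw [Submodule.map_span]
  simp

lemma map_reflection_normalLine (a b : ℝ) :
    (normalLine b).map ((normalLine a).reflection.toLinearEquiv : Plane →ₗ[ℝ] Plane) =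
      normalLine (2 * a - b) := by
  rw [map_normalLine (reflection_normalLine_polar a b), normalLine_eq_iff]
  exact ⟨1, by push_cast; ring⟩

end Polar

/-! ### Cotangents of planar configurations -/

section Cot

namespace PlanarConfig

variable {ι : Type*} (B : PlanarConfig ι)

lemma cvec_dotProduct (i j : ι) :
    B.cvec i ⬝ᵥ B.cvec j = (Real.cos (B.angle j - B.angle i) : ℝ) := by
  simp [cvec, vec, dotProduct, Fin.sum_univ_two, Complex.cos_sub]; ring

lemma cvec_dotProduct_self (i : ι) : B.cvec i ⬝ᵥ B.cvec i = 1 := by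
  rw [cvec_dotProduct, sub_self, Real.cos_zero, Complex.ofReal_one]

lemma perp_cvec_dotProduct (i j : ι) :
    perp (B.cvec i) ⬝ᵥ B.cvec j = (Real.sin (B.angle j - B.angle i) : ℝ) := by
  simp [cvec, vec, perp, dotProduct, Fin.sum_univ_two, Complex.sin_sub]; ring

lemma cotBetween_cvec (i j : ι) : cotBetween (B.cvec i) (B.cvec j) =
    (Real.cos (B.angle j - B.angle i) / Real.sin (B.angle j - B.angle i) : ℝ) := by
  rw [cotBetween, cvec_dotProduct, perp_cvec_dotProduct, Complex.ofReal_div]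

lemma z_add_z_div_z_sub_z (i j : ι) :
    (B.z j + B.z i) / (B.z j - B.z i) = -Complex.I * cotBetween (B.cvec i) (B.cvec j) := by
  obtain ⟨d, hd⟩ : ∃ d : ℝ, d = B.angle j - B.angle i := ⟨_, rfl⟩
  obtain ⟨e, he⟩ : ∃ e : ℂ, e = Complex.exp (Complex.I * (B.angle i + B.angle j)) := ⟨_, rfl⟩
  have hz1 : B.z j = e * Complex.exp (d * Complex.I) := by
    rw [he, ← Complex.exp_add, z, hd]; congr 1; push_cast; ring
  have hz2 : B.z i = e * Complex.exp (-d * Complex.I) := by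
    rw [he, ← Complex.exp_add, z, hd]; congr 1; push_cast; ring
  have h1 : B.z j + B.z i = (2 * e) * Complex.cos d := by
    rw [hz1, hz2, Complex.cos]; ring
  have h2 : B.z j - B.z i = (2 * e) * (Complex.I * Complex.sin d) := by
    rw [hz1, hz2, Complex.sin]
    linear_combination (e * (Complex.exp (d * Complex.I) - Complex.exp (-d * Complex.I))) *
      Complex.I_mul_I
  have he0 : (2 * e) ≠ 0 := mul_ne_zero two_ne_zero (he ▸ Complex.exp_ne_zero _)
  rw [h1, h2, mul_div_mul_left _ _ he0, cotBetween_cvec, ← hd, Complex.ofReal_div,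
    Complex.ofReal_cos, Complex.ofReal_sin, div_mul_eq_div_div_swap, div_eq_mul_inv _ Complex.I,
    Complex.inv_I]
  ring

lemma cotBetween_eq_z (i j : ι) :
    cotBetween (B.cvec i) (B.cvec j) = Complex.I * ((B.z j + B.z i) / (B.z j - B.z i)) := by
  rw [z_add_z_div_z_sub_z]
  linear_combination (cotBetween (B.cvec i) (B.cvec j)) * Complex.I_mul_I

/-- Division by sin 0 = 0 has value 0, so cotangent sums may run over all indices, including the
base line. -/
lemma cotBetween_self (i : ι) : cotBetween (B.cvec i) (B.cvec i) = 0 := by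
  simp [cotBetween_cvec]

lemma cotBetween_reflect {i j k : ι} {n : ℤ}
    (h : B.angle k = 2 * B.angle i - B.angle j + n * Real.pi) :
    cotBetween (B.cvec i) (B.cvec k) = -cotBetween (B.cvec i) (B.cvec j) := by
  rw [cotBetween_cvec, cotBetween_cvec, h, ← Complex.ofReal_neg]
  congr 1
  have : 2 * B.angle i - B.angle j + n * Real.pi - B.angle i =
      -(B.angle j - B.angle i) + n * Real.pi := by ring
  rw [this, Real.cos_add_int_mul_pi, Real.sin_add_int_mul_pi,
    mul_div_mul_left _ _ (zpow_ne_zero _ (by norm_num)), Real.cos_neg, Real.sin_neg, div_neg]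

variable [Fintype ι]

/-- Odd power sums of cotangents vanish if the configuration is symmetric in the line `i`. -/
lemma sum_cotBetween_pow_eq_zero_of_symmetric
    (hB : Pairwise fun i j => Real.sin (B.angle i - B.angle j) ≠ 0) (i : ι)
    (hsymm : ∀ j, ∃ k, B.mult k = B.mult j ∧
      ∃ n : ℤ, B.angle k = 2 * B.angle i - B.angle j + n * Real.pi) {a : ℕ} (ha : Odd a) :
    ∑ j, (B.mult j : ℂ) * cotBetween (B.cvec i) (B.cvec j) ^ a = 0 := by
  choose τ hm n hn using hsymm
  have hinj : Function.Injective τ := by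
    intro j j' h
    by_contra hne
    refine hB hne (sin_sub_eq_zero_iff.2 ⟨n j - n j', ?_⟩)
    have h1 := hn j
    have h2 := hn j'
    rw [h] at h1
    push_cast
    linarith
  have hbij : Function.Bijective τ := Finite.injective_iff_bijective.1 hinj
  have := hbij.sum_comp fun j => (B.mult j : ℂ) * cotBetween (B.cvec i) (B.cvec j) ^ a
  simp only [hm, cotBetween_reflect B (hn _), ha.neg_pow, mul_neg, Finset.sum_neg_distrib] at this
  -- Reindexing by the reflection changes the sign of every odd power, so the sum equals its own
  -- negative.
  exact self_eq_neg.1 this.symm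

lemma locusEquations_iff [DecidableEq ι] : LocusEquations B.cvec B.mult ↔
    ∀ i r, 1 ≤ r → r ≤ B.mult i →
      ∑ j, (B.mult j : ℂ) * cotBetween (B.cvec i) (B.cvec j) ^ (2 * r - 1) = 0 := by
  refine forall_congr' fun i => forall_congr' fun r => forall_congr' fun h1 => forall_congr'
    fun h2 => ?_
  rw [← Finset.add_sum_erase _ _ (Finset.mem_univ i), cotBetween_self,
    zero_pow (by omega), mul_zero, zero_add]

end PlanarConfig

/-- The multiplication formula for the cotangent. -/
lemma sum_range_rootOfUnity_add_div_sub {q : ℕ} (hq : 1 ≤ q) {ζ : ℂ} (hζ : IsPrimitiveRoot ζ q)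
    {a b : ℂ} (hab : a ^ q ≠ b ^ q) :
    ∑ s ∈ Finset.range q, (a * ζ ^ s + b) / (a * ζ ^ s - b) =
      q * ((a ^ q + b ^ q) / (a ^ q - b ^ q)) := by
  have hprod := X_pow_sub_C_eq_prod hζ (by omega) (rfl : a ^ q = a ^ q)
  have hev : ∀ x : ℂ, x ^ q - a ^ q = ∏ s ∈ Finset.range q, (x - ζ ^ s * a) := by
    intro x
    have := congrArg (Polynomial.eval x) hprod
    simpa [Polynomial.eval_prod] using this
  have hne : ∀ s ∈ Finset.range q, b - ζ ^ s * a ≠ 0 := by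
    rw [← Finset.prod_ne_zero_iff, ← hev]
    exact sub_ne_zero.2 hab.symm
  -- The sum of 1/(b - ζˢa) is the logarithmic derivative at b of x^q - a^q = ∏ (x - ζˢa); here the
  -- derivative is computed from both sides.
  have hder : (q : ℂ) * b ^ (q - 1) =
      ∑ s ∈ Finset.range q, ∏ t ∈ (Finset.range q).erase s, (b - ζ ^ t * a) := by
    have h1 : HasDerivAt (fun x : ℂ => x ^ q - a ^ q) (q * b ^ (q - 1)) b := by
      simpa using (hasDerivAt_pow q b).sub_const (a ^ q)
    have h2 : HasDerivAt (fun x : ℂ => ∏ s ∈ Finset.range q, (x - ζ ^ s * a))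
        (∑ s ∈ Finset.range q, ∏ t ∈ (Finset.range q).erase s, (b - ζ ^ t * a)) b := by
      have := HasDerivAt.fun_finsetProd (u := Finset.range q) (x := b)
        (f := fun s x => x - ζ ^ s * a) (f' := fun _ => 1)
        (fun s _ => (hasDerivAt_id b).sub_const (ζ ^ s * a))
      simpa using this
    simp only [← hev] at h2
    exact h1.unique h2
  have hlog : ∑ s ∈ Finset.range q, (b - ζ ^ s * a)⁻¹ = q * b ^ (q - 1) / (b ^ q - a ^ q) := by
    rw [hder, Finset.sum_div, hev b]
    refine Finset.sum_congr rfl fun s hs => ?_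
    rw [← Finset.mul_prod_erase _ (fun t => b - ζ ^ t * a) hs,
      div_mul_cancel_right₀ (Finset.prod_ne_zero_iff.2 fun t ht => hne t (Finset.mem_of_mem_erase ht))]
  have hterm : ∀ s ∈ Finset.range q, (a * ζ ^ s + b) / (a * ζ ^ s - b) =
      1 - 2 * b * (b - ζ ^ s * a)⁻¹ := by
    intro s hs
    have h := hne s hs
    rw [show a * ζ ^ s + b = 2 * b - (b - ζ ^ s * a) by ring,
      show a * ζ ^ s - b = -(b - ζ ^ s * a) by ring]
    generalize b - ζ ^ s * a = w at h
    field_simp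
    ring
  rw [Finset.sum_congr rfl hterm, Finset.sum_sub_distrib, ← Finset.mul_sum, hlog]
  have h1 : b ^ q - a ^ q ≠ 0 := sub_ne_zero.2 hab.symm
  have h2 : a ^ q - b ^ q ≠ 0 := sub_ne_zero.2 hab
  have h3 : b * b ^ (q - 1) = b ^ q := by rw [← pow_succ', Nat.sub_add_cancel hq]
  simp only [Finset.sum_const, Finset.card_range, nsmul_eq_mul, mul_one]
  rw [← mul_div_assoc, ← mul_div_assoc, sub_eq_iff_eq_add, div_add_div _ _ h2 h1,
    eq_div_iff (mul_ne_zero h2 h1)]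
  linear_combination (-2 * (q : ℂ) * (a ^ q - b ^ q)) * h3

end Cot

/-! ### The unfolding `T q` -/

/-- Indices s = 1, …, q are stored as `s + 1` with `s : Fin q`, so the residue taken is that of x -
1. -/
lemma exists_fin_add_one_eq {q : ℕ} (hq : 1 ≤ q) (x : ℤ) :
    ∃ (s : Fin q) (k : ℤ), ((s : ℕ) : ℤ) + 1 = x + q * k := by
  have hq' : (0 : ℤ) < q := by exact_mod_cast hq
  have h1 := Int.emod_nonneg (x - 1) hq'.ne'
  have h2 := Int.emod_lt_of_pos (x - 1) hq'
  have h3 := Int.emod_add_mul_ediv (x - 1) q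
  refine ⟨⟨((x - 1) % q).toNat, by omega⟩, -((x - 1) / q), ?_⟩
  simp only [Int.toNat_of_nonneg h1]
  linarith

namespace PlanarConfig

variable {ι : Type*} (A : PlanarConfig ι) {q : ℕ}

@[simp] lemma T_mult (a : ι × Fin q) : (A.T q).mult a = A.mult a.1 := rfl

/-- Any angle congruent to `q⁻¹ (φᵢ + π x)` with `x` an integer occurs in `T q A`. -/
lemma exists_T_angle_eq (hq : 1 ≤ q) (i : ι) (x : ℤ) :
    ∃ (s : Fin q) (k : ℤ), (A.T q).angle (i, s) = (A.angle i + x * Real.pi) / q + k * Real.pi := by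
  obtain ⟨s, k, h⟩ := exists_fin_add_one_eq hq x
  refine ⟨s, k, ?_⟩
  have hq0 : (q : ℝ) ≠ 0 := by exact_mod_cast (by omega : q ≠ 0)
  have h' : ((s : ℕ) : ℝ) + 1 = x + q * k := by exact_mod_cast h
  simp only [T, h']
  field_simp
  ring

lemma sin_T_angle_sub_ne_zero (hq : 1 ≤ q)
    (hA : Pairwise fun i j => Real.sin (A.angle i - A.angle j) ≠ 0) :
    Pairwise fun a b => Real.sin ((A.T q).angle a - (A.T q).angle b) ≠ 0 := by
  rintro ⟨i, s⟩ ⟨j, t⟩ hne hs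
  obtain ⟨k, hk⟩ := sin_sub_eq_zero_iff.1 hs
  have hq0 : (q : ℝ) ≠ 0 := by exact_mod_cast (by omega : q ≠ 0)
  simp only [T] at hk
  have hk' : A.angle i + Real.pi * ((s : ℕ) + 1) =
      A.angle j + Real.pi * ((t : ℕ) + 1) + q * k * Real.pi := by
    field_simp at hk
    linarith
  have hij : i = j := by
    by_contra hij
    refine hA hij (sin_sub_eq_zero_iff.2 ⟨(t : ℕ) - (s : ℕ) + q * k, ?_⟩)
    push_cast
    linarith
  subst hij
  apply hne
  have h1 : ((s : ℕ) : ℝ) = (t : ℕ) + q * k := by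
    have : Real.pi * (((s : ℕ) : ℝ) - ((t : ℕ) + q * k)) = 0 := by linarith
    linarith [(mul_eq_zero.1 this).resolve_left Real.pi_ne_zero]
  have h2 : ((s : ℕ) : ℤ) = (t : ℕ) + q * k := by exact_mod_cast h1
  have hs := s.2
  have ht := t.2
  -- Two indices below q that are congruent modulo q must coincide.
  have hk0 : k = 0 := by
    by_contra hk0
    rcases lt_or_gt_of_ne hk0 with h | h
    · have : (q : ℤ) * k ≤ q * (-1) := by gcongr; omega
      omega
    · have : (q : ℤ) * 1 ≤ q * k := by gcongr; omega
      omega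
  rw [hk0] at h2
  congr 1
  ext
  omega

lemma T_z (i : ι) (s : Fin q) : (A.T q).z (i, s) =
    Complex.exp (2 * Complex.I * (A.angle i / q)) * Complex.exp (2 * Real.pi * Complex.I / q) *
      Complex.exp (2 * Real.pi * Complex.I / q) ^ (s : ℕ) := by
  rw [← Complex.exp_nat_mul, ← Complex.exp_add, ← Complex.exp_add, z, T]
  congr 1
  push_cast
  ring

lemma T_z_pow (hq : 1 ≤ q) (i : ι) (s : Fin q) : (A.T q).z (i, s) ^ q = A.z i := by
  have hq0 : (q : ℂ) ≠ 0 := by exact_mod_cast (by omega : q ≠ 0)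
  rw [z, ← Complex.exp_nat_mul, z, T]
  rw [Complex.exp_eq_exp_iff_exists_int]
  refine ⟨(s : ℕ) + 1, ?_⟩
  push_cast
  field_simp

lemma z_ne_z {i j : ι} (h : Real.sin (A.angle i - A.angle j) ≠ 0) : A.z i ≠ A.z j := by
  intro hz
  apply h
  rw [z, z, Complex.exp_eq_exp_iff_exists_int] at hz
  obtain ⟨k, hk⟩ := hz
  refine sin_sub_eq_zero_iff.2 ⟨k, ?_⟩
  have h2 : (2 * Complex.I) * (A.angle i : ℂ) =
      (2 * Complex.I) * ((A.angle j + k * Real.pi : ℝ) : ℂ) := by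
    rw [hk]; push_cast; ring
  exact_mod_cast mul_left_cancel₀ (mul_ne_zero two_ne_zero Complex.I_ne_zero) h2

lemma sum_cotBetween_T_of_ne (hq : 1 ≤ q) {i j : ι} (t : Fin q)
    (h : Real.sin (A.angle j - A.angle i) ≠ 0) :
    ∑ s : Fin q, cotBetween ((A.T q).cvec (i, t)) ((A.T q).cvec (j, s)) =
      q * cotBetween (A.cvec i) (A.cvec j) := by
  simp only [cotBetween_eq_z]
  rw [← Finset.mul_sum]
  obtain ⟨b, hb⟩ : ∃ b, b = (A.T q).z (i, t) := ⟨_, rfl⟩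
  obtain ⟨ζ, hζ⟩ : ∃ ζ, ζ = Complex.exp (2 * Real.pi * Complex.I / q) := ⟨_, rfl⟩
  obtain ⟨a, ha⟩ : ∃ a, a = Complex.exp (2 * Complex.I * (A.angle j / q)) * ζ := ⟨_, rfl⟩
  have hprim : IsPrimitiveRoot ζ q := hζ ▸ Complex.isPrimitiveRoot_exp q (by omega)
  have hz : ∀ s : Fin q, (A.T q).z (j, s) = a * ζ ^ (s : ℕ) := by
    intro s
    rw [ha, hζ, T_z]
  have haq : a ^ q = A.z j := by
    rw [← T_z_pow A hq j t, hz, mul_pow, ← pow_mul, mul_comm (t : ℕ) q, pow_mul, hprim.pow_eq_one,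
      one_pow, mul_one]
  have hbq : b ^ q = A.z i := hb ▸ T_z_pow A hq i t
  simp only [hz, ← hb]
  rw [Fin.sum_univ_eq_sum_range (fun s => (a * ζ ^ s + b) / (a * ζ ^ s - b)),
    sum_range_rootOfUnity_add_div_sub hq hprim (by rw [haq, hbq]; exact A.z_ne_z h), haq, hbq]
  ring

/-- The lines of `T q A` lying over one line of `A` balance each other. -/
lemma sum_cotBetween_T_self (hq : 1 ≤ q) (i : ι) (t : Fin q) :
    ∑ s : Fin q, cotBetween ((A.T q).cvec (i, t)) ((A.T q).cvec (i, s)) = 0 := by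
  let A₀ : PlanarConfig Unit := ⟨fun _ => A.angle i, fun _ => 1⟩
  let B : PlanarConfig (Fin q) := ⟨fun s => (A₀.T q).angle ((), s), fun _ => 1⟩
  have hsub : Pairwise fun s s' => Real.sin (B.angle s - B.angle s') ≠ 0 := by
    intro s s' hss
    exact A₀.sin_T_angle_sub_ne_zero hq (fun x y hxy => absurd (Subsingleton.elim x y) hxy)
      (by simpa using hss : ((), s) ≠ ((), s'))
  have := B.sum_cotBetween_pow_eq_zero_of_symmetric hsub t (fun s => by
    -- Reflection in the t-th of these q equally spaced lines sends the index s to 2t - s modulo q.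
    obtain ⟨s', k, hs'⟩ := A₀.exists_T_angle_eq hq ()
      (2 * (((t : ℕ) : ℤ) + 1) - (((s : ℕ) : ℤ) + 1))
    refine ⟨s', rfl, k, hs'.trans ?_⟩
    simp only [B, T]
    push_cast
    ring) odd_one
  simp only [B, pow_one, Nat.cast_one, one_mul] at this
  exact this

end PlanarConfig

/-! ### Symmetry of A_(m, m', 1^n) and the locus equations of its unfolding. -/

namespace IsAmm

variable {m m' n : ℕ} {A : PlanarConfig (Fin (n + 2))} (h : IsAmm m m' n A)

include h

lemma sin_ne_zero : Pairwise fun i j => Real.sin (A.angle i - A.angle j) ≠ 0 :=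
  fun _ _ hij => linearIndependent_polar.1 (h.noncollinear hij.symm)

lemma eq_of_angle_eq {i j : Fin (n + 2)} {k : ℤ} (hk : A.angle i = A.angle j + k * Real.pi) :
    i = j := by
  by_contra hij
  exact h.sin_ne_zero hij (sin_sub_eq_zero_iff.2 ⟨k, hk⟩)

lemma angle_last : ∃ k : ℤ,
    A.angle (Fin.last (n + 1)) = A.angle 0 + Real.pi / 2 + k * Real.pi := by
  have := h.orthogonal
  rw [PlanarConfig.vec, PlanarConfig.vec, inner_polar, Real.cos_eq_zero_iff] at this
  obtain ⟨k, hk⟩ := this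
  exact ⟨-k - 1, by push_cast; linarith⟩

lemma exists_reflect (i : Fin (n + 2)) :
    ∃ j, ∃ k : ℤ, A.angle j = 2 * A.angle 0 - A.angle i + k * Real.pi := by
  have : (A.line i).map ((A.line 0).reflection.toLinearEquiv : Plane →ₗ[ℝ] Plane) ∈
      Set.range A.line := by
    rw [← h.symmetric]
    exact ⟨_, ⟨i, rfl⟩, rfl⟩
  obtain ⟨j, hj⟩ := this
  rw [PlanarConfig.line, PlanarConfig.line, PlanarConfig.line, map_reflection_normalLine] at hj
  exact ⟨j, normalLine_eq_iff.1 hj⟩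

lemma two_mul_angle_last : ∃ k : ℤ,
    2 * A.angle (Fin.last (n + 1)) = 2 * A.angle 0 + k * Real.pi := by
  obtain ⟨k, hk⟩ := h.angle_last
  exact ⟨1 + 2 * k, by push_cast; linarith⟩

/-- The mirror lines `α₀` and `α_{n+1}` are the only ones fixed by the reflection. -/
lemma eq_zero_or_eq_last_iff (i : Fin (n + 2)) : (i = 0 ∨ i = Fin.last (n + 1)) ↔
    ∃ k : ℤ, 2 * A.angle i = 2 * A.angle 0 + k * Real.pi := by
  constructor
  · rintro (rfl | rfl)
    · exact ⟨0, by simp⟩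
    · exact h.two_mul_angle_last
  · rintro ⟨k, hk⟩
    rcases Int.even_or_odd' k with ⟨l, rfl | rfl⟩
    · exact Or.inl (h.eq_of_angle_eq (k := l) (by push_cast at hk; linarith))
    · obtain ⟨k', hk'⟩ := h.angle_last
      exact Or.inr (h.eq_of_angle_eq (k := l - k') (by push_cast at hk ⊢; linarith))

lemma reflect_eq_zero_or_last_iff {i j : Fin (n + 2)} {k : ℤ}
    (hk : A.angle j = 2 * A.angle 0 - A.angle i + k * Real.pi) :
    (j = 0 ∨ j = Fin.last (n + 1)) ↔ (i = 0 ∨ i = Fin.last (n + 1)) := by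
  rw [h.eq_zero_or_eq_last_iff, h.eq_zero_or_eq_last_iff]
  exact ⟨fun ⟨l, hl⟩ => ⟨2 * k - l, by push_cast; linarith⟩,
    fun ⟨l, hl⟩ => ⟨2 * k - l, by push_cast; linarith⟩⟩

/-- The symmetry hypothesis speaks of lines only. Multiplicities are respected because the two
special lines are fixed, while all the others are permuted among themselves and have multiplicity
one. -/
lemma mult_reflect {i j : Fin (n + 2)} {k : ℤ}
    (hk : A.angle j = 2 * A.angle 0 - A.angle i + k * Real.pi) : A.mult j = A.mult i := by
  have hiff := h.reflect_eq_zero_or_last_iff hk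
  by_cases hi : i = 0 ∨ i = Fin.last (n + 1)
  · obtain ⟨l, hl⟩ := (h.eq_zero_or_eq_last_iff i).1 hi
    rw [h.eq_of_angle_eq (i := j) (j := i) (k := k - l) (by push_cast; linarith)]
  · have hj := mt hiff.1 hi
    push Not at hi hj
    rw [h.mult_one i hi.1 hi.2, h.mult_one j hj.1 hj.2]

lemma locusEquations_T {q : ℕ} (hq : 1 ≤ q) : LocusEquations (A.T q).cvec (A.T q).mult := by
  rw [PlanarConfig.locusEquations_iff]
  rintro ⟨i, t⟩ r h1 h2
  by_cases hi : i = 0 ∨ i = Fin.last (n + 1)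
  · refine (A.T q).sum_cotBetween_pow_eq_zero_of_symmetric
      (A.sin_T_angle_sub_ne_zero hq h.sin_ne_zero) (i, t) ?_ ⟨r - 1, by omega⟩
    rintro ⟨j, s⟩
    obtain ⟨l, hl⟩ := (h.eq_zero_or_eq_last_iff i).1 hi
    obtain ⟨j', k, hk⟩ := h.exists_reflect j
    -- The integer is read off from q(2φ_{i,t} - φ_{j,s}) = φ_{j'} + (l - k + 2(t+1) - (s+1))π,
    -- where 2φᵢ = 2φ₀ + lπ.
    obtain ⟨s', k', hs'⟩ := A.exists_T_angle_eq hq j'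
      (l - k + 2 * (((t : ℕ) : ℤ) + 1) - (((s : ℕ) : ℤ) + 1))
    refine ⟨(j', s'), h.mult_reflect hk, k', hs'.trans ?_⟩
    simp only [PlanarConfig.T, hk]
    push_cast
    linear_combination -hl / q
  · push Not at hi
    have hm : (A.T q).mult (i, t) = 1 := h.mult_one i hi.1 hi.2
    obtain rfl : r = 1 := by omega
    have hloc := h.locus i hi.1 hi.2
    simp only [PlanarConfig.z_add_z_div_z_sub_z] at hloc
    simp only [mul_one, Nat.add_one_sub_one, pow_one, Fintype.sum_prod_type]
    have hsum : ∀ j, ∑ s : Fin q, ((A.T q).mult (j, s) : ℂ) *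
        cotBetween ((A.T q).cvec (i, t)) ((A.T q).cvec (j, s)) =
        q * (A.mult j * cotBetween (A.cvec i) (A.cvec j)) := by
      intro j
      simp only [PlanarConfig.T_mult]
      rw [← Finset.mul_sum]
      by_cases hij : i = j
      · subst hij
        rw [A.sum_cotBetween_T_self hq, PlanarConfig.cotBetween_self]
        simp
      · rw [A.sum_cotBetween_T_of_ne hq t (h.sin_ne_zero (Ne.symm hij))]
        ring
    simp only [hsum]
    rw [← Finset.mul_sum, ← Finset.add_sum_erase _ _ (Finset.mem_univ i),
      PlanarConfig.cotBetween_self, mul_zero, zero_add]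
    have e : ∑ j ∈ Finset.univ.erase i, (A.mult j : ℂ) *
        (-Complex.I * cotBetween (A.cvec i) (A.cvec j)) =
        -Complex.I * ∑ j ∈ Finset.univ.erase i, (A.mult j : ℂ) *
          cotBetween (A.cvec i) (A.cvec j) := by
      rw [Finset.mul_sum]
      exact Finset.sum_congr rfl fun j _ => by ring
    rw [e] at hloc
    rw [(mul_eq_zero.1 hloc).resolve_left (neg_ne_zero.2 Complex.I_ne_zero), mul_zero]

lemma perp_T_cvec_ne_zero {q : ℕ} (hq : 1 ≤ q) :
    Pairwise fun a b => perp ((A.T q).cvec a) ⬝ᵥ (A.T q).cvec b ≠ 0 := by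
  intro a b hab
  rw [PlanarConfig.perp_cvec_dotProduct]
  exact_mod_cast A.sin_T_angle_sub_ne_zero hq h.sin_ne_zero hab.symm

lemma isConfiguration_T {q : ℕ} (hq : 1 ≤ q) : IsConfiguration (A.T q).cvec :=
  ⟨fun i => by rw [PlanarConfig.cvec_dotProduct_self]; exact one_ne_zero, fun _ _ hab =>
    linearIndependent_of_perp_dotProduct_ne_zero (h.perp_T_cvec_ne_zero hq hab)⟩

lemma admitsBA_T {q : ℕ} (hq : 1 ≤ q) : AdmitsBA (A.T q).cvec (A.T q).mult :=
  admitsBA_of_locusEquations (fun i => by simp only [PlanarConfig.cvec_dotProduct_self])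
    (h.perp_T_cvec_ne_zero hq) (h.locusEquations_T hq)

end IsAmm

/-! ### Existence of the configurations -/

section Stieltjes

variable {N : ℕ}

/-- The exponential of minus the energy of charges on `(0, 1)`. -/
def boltzmann (a b : ℕ) (u : Fin N → ℝ) : ℝ :=
  (∏ j, u j ^ a * (1 - u j) ^ b) * ∏ j, ∏ k ∈ Finset.univ.erase j, (u j - u k) ^ 2

/-- The part of `boltzmann` which does not depend on the `j`-th charge. -/
def boltzmannOff (a b : ℕ) (j : Fin N) (u : Fin N → ℝ) : ℝ :=
  (∏ i ∈ Finset.univ.erase j, u i ^ a * (1 - u i) ^ b) *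
    ∏ i ∈ Finset.univ.erase j, ∏ k ∈ (Finset.univ.erase i).erase j, (u i - u k) ^ 2

/-- Each unordered pair occurs twice in the double product, so the dependence on one charge is
through fourth powers. -/
lemma boltzmann_eq (a b : ℕ) (j : Fin N) (u : Fin N → ℝ) :
    boltzmann a b u = (u j ^ a * (1 - u j) ^ b * ∏ k ∈ Finset.univ.erase j, (u j - u k) ^ 4) *
      boltzmannOff a b j u := by
  have h : ∏ i ∈ Finset.univ.erase j, ∏ k ∈ Finset.univ.erase i, (u i - u k) ^ 2 =
      (∏ i ∈ Finset.univ.erase j, (u j - u i) ^ 2) *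
        ∏ i ∈ Finset.univ.erase j, ∏ k ∈ (Finset.univ.erase i).erase j, (u i - u k) ^ 2 := by
    rw [← Finset.prod_mul_distrib]
    refine Finset.prod_congr rfl fun i hi => ?_
    rw [← Finset.mul_prod_erase (Finset.univ.erase i) _
      (Finset.mem_erase.2 ⟨(Finset.ne_of_mem_erase hi).symm, Finset.mem_univ j⟩)]
    ring
  rw [boltzmann, boltzmannOff,
    ← Finset.mul_prod_erase Finset.univ (fun j => u j ^ a * (1 - u j) ^ b) (Finset.mem_univ j),
    ← Finset.mul_prod_erase Finset.univ (fun j => ∏ k ∈ Finset.univ.erase j, (u j - u k) ^ 2)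
      (Finset.mem_univ j), h,
    show ∏ k ∈ Finset.univ.erase j, (u j - u k) ^ 4 =
      (∏ k ∈ Finset.univ.erase j, (u j - u k) ^ 2) * ∏ k ∈ Finset.univ.erase j, (u j - u k) ^ 2 by
      rw [← Finset.prod_mul_distrib]; exact Finset.prod_congr rfl fun _ _ => by ring]
  ring

lemma boltzmannOff_update (a b : ℕ) (j : Fin N) (u : Fin N → ℝ) (x : ℝ) :
    boltzmannOff a b j (Function.update u j x) = boltzmannOff a b j u := by
  rw [boltzmannOff, boltzmannOff]
  congr 1
  · refine Finset.prod_congr rfl fun i hi => ?_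
    rw [Function.update_of_ne (Finset.ne_of_mem_erase hi)]
  · refine Finset.prod_congr rfl fun i hi => Finset.prod_congr rfl fun k hk => ?_
    rw [Function.update_of_ne (Finset.ne_of_mem_erase hi),
      Function.update_of_ne (Finset.ne_of_mem_erase hk)]

lemma hasDerivAt_log_energy (a b : ℕ) {u : Fin N → ℝ} (j : Fin N) (h0 : u j ≠ 0)
    (h1 : 1 - u j ≠ 0) (hu : ∀ k ∈ Finset.univ.erase j, u j - u k ≠ 0) :
    HasDerivAt (fun x : ℝ => Real.log (x ^ a * (1 - x) ^ b *
        ∏ k ∈ Finset.univ.erase j, (x - u k) ^ 4))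
      (a / u j - b / (1 - u j) + ∑ k ∈ Finset.univ.erase j, 4 / (u j - u k)) (u j) := by
  have hd : HasDerivAt (fun x : ℝ => a * Real.log x + b * Real.log (1 - x) +
      ∑ k ∈ Finset.univ.erase j, 4 * Real.log (x - u k))
      (a / u j - b / (1 - u j) + ∑ k ∈ Finset.univ.erase j, 4 / (u j - u k)) (u j) := by
    have e1 := (Real.hasDerivAt_log h0).const_mul (a : ℝ)
    have e2 := ((((hasDerivAt_id (u j)).const_sub 1).log h1)).const_mul (b : ℝ)
    have e3 : ∀ k ∈ Finset.univ.erase j, HasDerivAt (fun x : ℝ => 4 * Real.log (x - u k))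
        (4 * (1 / (u j - u k))) (u j) := fun k hk =>
      (((hasDerivAt_id (u j)).sub_const (u k)).log (hu k hk)).const_mul 4
    refine ((e1.fun_add e2).fun_add (HasDerivAt.fun_sum e3)).congr_deriv ?_
    simp only [div_eq_mul_inv, id]
    ring_nf
  refine hd.congr_of_eventuallyEq ?_
  have c1 : ∀ᶠ x in nhds (u j), x ≠ 0 := (continuousAt_id).eventually_ne h0
  have c2 : ∀ᶠ x in nhds (u j), 1 - x ≠ 0 :=
    (continuousAt_const.sub continuousAt_id).eventually_ne h1
  have c3 : ∀ᶠ x in nhds (u j), ∀ k ∈ Finset.univ.erase j, x - u k ≠ 0 :=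
    (Filter.eventually_all_finset _).2 fun k hk =>
      (continuousAt_id.sub continuousAt_const).eventually_ne (hu k hk)
  filter_upwards [c1, c2, c3] with x x1 x2 x3
  rw [Real.log_mul (mul_ne_zero (pow_ne_zero _ x1) (pow_ne_zero _ x2))
      (Finset.prod_ne_zero_iff.2 fun k hk => pow_ne_zero _ (x3 k hk)),
    Real.log_mul (pow_ne_zero _ x1) (pow_ne_zero _ x2), Real.log_pow, Real.log_pow,
    Real.log_prod fun k hk => pow_ne_zero _ (x3 k hk)]
  simp only [Real.log_pow, Nat.cast_ofNat]

/-- Stieltjes' electrostatic equilibrium on `(0, 1)`: the charges are the roots of a Jacobi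
polynomial. -/
lemma exists_electrostatic_equilibrium (N a b : ℕ) (ha : a ≠ 0) (hb : b ≠ 0) :
    ∃ u : Fin N → ℝ, (∀ j, 0 < u j ∧ u j < 1) ∧ Function.Injective u ∧
      ∀ j, a / u j - b / (1 - u j) + ∑ k ∈ Finset.univ.erase j, 4 / (u j - u k) = 0 := by
  have hF : Continuous (boltzmann (N := N) a b) := by unfold boltzmann; fun_prop
  have hpos : ∀ u : Fin N → ℝ, (∀ j, 0 < u j ∧ u j < 1) → Function.Injective u →
      0 < boltzmann a b u := by
    intro u hu hinj
    refine mul_pos (Finset.prod_pos fun j _ => mul_pos (pow_pos (hu j).1 _)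
      (pow_pos (sub_pos.2 (hu j).2) _)) (Finset.prod_pos fun j _ => Finset.prod_pos fun k hk => ?_)
    have := sub_ne_zero.2 (hinj.ne (Finset.ne_of_mem_erase hk).symm)
    positivity
  obtain ⟨u, huI, hmax⟩ := (isCompact_Icc (a := (0 : Fin N → ℝ)) (b := 1)).exists_isMaxOn
    ⟨0, by simp⟩ hF.continuousOn
  have hmem : ∀ w : Fin N → ℝ, (∀ j, 0 < w j ∧ w j < 1) → w ∈ Set.Icc (0 : Fin N → ℝ) 1 :=
    fun w hw => ⟨fun j => (hw j).1.le, fun j => (hw j).2.le⟩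
  -- Comparison with equally spaced charges: the maximum is positive, so no charge of a maximizer
  -- lies on a wall or on another charge.
  have hupos : 0 < boltzmann a b u := by
    let v : Fin N → ℝ := fun j => ((j : ℕ) + 1) / (N + 1)
    have hv : ∀ j, 0 < v j ∧ v j < 1 := by
      intro j
      refine ⟨by positivity, ?_⟩
      rw [div_lt_one (by positivity)]
      have : ((j : ℕ) : ℝ) < N := by exact_mod_cast j.2
      linarith
    have hvinj : Function.Injective v := by
      intro i j hij
      have h0 : ((N : ℝ) + 1) ≠ 0 := by positivity
      have := (div_left_inj' h0).1 hij
      ext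
      exact_mod_cast add_right_cancel this
    exact (hpos v hv hvinj).trans_le (hmax (hmem v hv))
  have hne := hupos.ne'
  have hfac : ∀ j, u j ≠ 0 ∧ 1 - u j ≠ 0 ∧ (∀ k ∈ Finset.univ.erase j, u j - u k ≠ 0) ∧
      boltzmannOff a b j u ≠ 0 := by
    intro j
    rw [boltzmann_eq a b j] at hne
    simp only [mul_ne_zero_iff, pow_ne_zero_iff ha, pow_ne_zero_iff hb, Finset.prod_ne_zero_iff,
      pow_ne_zero_iff (four_ne_zero)] at hne
    exact ⟨hne.1.1.1, hne.1.1.2, hne.1.2, hne.2⟩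
  have hu : ∀ j, 0 < u j ∧ u j < 1 := fun j =>
    ⟨lt_of_le_of_ne (huI.1 j) (hfac j).1.symm,
      lt_of_le_of_ne (huI.2 j) fun h => (hfac j).2.1 (by rw [h]; simp)⟩
  refine ⟨u, hu, fun i j hij => ?_, fun j => ?_⟩
  · by_contra hne'
    exact (hfac i).2.2.1 j (Finset.mem_erase.2 ⟨fun h => hne' h.symm, Finset.mem_univ _⟩)
      (sub_eq_zero.2 hij)
  -- Moving one charge and dividing by the positive factor `boltzmannOff`, which does not feel the
  -- move, leaves a one-variable maximum.
  have hmax' : IsLocalMax (fun x : ℝ => Real.log (x ^ a * (1 - x) ^ b *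
      ∏ k ∈ Finset.univ.erase j, (x - u k) ^ 4)) (u j) := by
    have hoff : 0 < boltzmannOff a b j u := by
      refine lt_of_le_of_ne ?_ (hfac j).2.2.2.symm
      exact mul_nonneg (Finset.prod_nonneg fun i _ => mul_nonneg (pow_nonneg (hu i).1.le _)
        (pow_nonneg (sub_nonneg.2 (hu i).2.le) _))
        (Finset.prod_nonneg fun i _ => Finset.prod_nonneg fun k _ => sq_nonneg _)
    have c3 : ∀ᶠ x in nhds (u j), ∀ k ∈ Finset.univ.erase j, x - u k ≠ 0 :=
      (Filter.eventually_all_finset _).2 fun k hk =>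
        (continuousAt_id.sub continuousAt_const).eventually_ne ((hfac j).2.2.1 k hk)
    filter_upwards [Ioo_mem_nhds (hu j).1 (hu j).2, c3] with x hx hx3
    have hxpos : 0 < x ^ a * (1 - x) ^ b * ∏ k ∈ Finset.univ.erase j, (x - u k) ^ 4 := by
      refine mul_pos (mul_pos (pow_pos hx.1 _) (pow_pos (sub_pos.2 hx.2) _))
        (Finset.prod_pos fun k hk => ?_)
      have := hx3 k hk
      positivity
    refine Real.log_le_log hxpos ?_
    have hle : boltzmann a b (Function.update u j x) ≤ boltzmann a b u := by
      refine hmax (hmem _ fun i => ?_)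
      by_cases hi : i = j
      · subst hi; simpa using hx
      · rw [Function.update_of_ne hi]; exact hu i
    rw [boltzmann_eq a b j, boltzmann_eq a b j u, boltzmannOff_update] at hle
    have := le_of_mul_le_mul_right hle hoff
    rw [Function.update_self, Finset.prod_congr rfl fun k hk => by
      rw [Function.update_of_ne (Finset.ne_of_mem_erase hk)]] at this
    exact this
  exact hmax'.hasDerivAt_eq_zero
    (hasDerivAt_log_energy a b j (hfac j).1 (hfac j).2.1 (hfac j).2.2.1)

/-- The logarithmic potential equations for `φ = arcsin √u`, in terms of cotangents. -/
lemma cot_sum_eq_zero_of_equilibrium (m m' : ℕ) {φ : Fin N → ℝ}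
    (hs : ∀ j, 0 < Real.sin (φ j)) (hc : ∀ j, 0 < Real.cos (φ j))
    (hinj : ∀ j k, j ≠ k → Real.sin (φ j) ^ 2 - Real.sin (φ k) ^ 2 ≠ 0)
    (hcrit : ∀ j, ((2 * m + 1 : ℕ) : ℝ) / Real.sin (φ j) ^ 2 -
      ((2 * m' + 1 : ℕ) : ℝ) / (1 - Real.sin (φ j) ^ 2) +
      ∑ k ∈ Finset.univ.erase j, 4 / (Real.sin (φ j) ^ 2 - Real.sin (φ k) ^ 2) = 0) (j : Fin N) :
    m * Real.cot (0 - φ j) + ((∑ k, Real.cot (φ k - φ j) + ∑ k, Real.cot (-φ k - φ j)) +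
      m' * Real.cot (Real.pi / 2 - φ j)) = 0 := by
  have hterm : ∀ k ∈ Finset.univ.erase j, Real.cot (φ k - φ j) + Real.cot (-φ k - φ j) =
      -(Real.sin (φ j) * Real.cos (φ j)) / 2 *
        (4 / (Real.sin (φ j) ^ 2 - Real.sin (φ k) ^ 2)) := by
    intro k hk
    have h := hinj j k (Finset.ne_of_mem_erase hk).symm
    have e : Real.sin (φ j) ^ 2 - Real.sin (φ k) ^ 2 =
        -(Real.sin (φ k - φ j) * Real.sin (φ k + φ j)) := by
      rw [Real.sin_sub, Real.sin_add]
      linear_combination Real.sin (φ k) ^ 2 * Real.sin_sq_add_cos_sq (φ j) -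
        Real.sin (φ j) ^ 2 * Real.sin_sq_add_cos_sq (φ k)
    have e2 : -φ k - φ j = -(φ k + φ j) := by ring
    rw [e] at h
    have h1 : Real.sin (φ k - φ j) ≠ 0 := fun h0 => h (by rw [h0]; ring)
    have h2 : Real.sin (φ k + φ j) ≠ 0 := fun h0 => h (by rw [h0]; ring)
    rw [e, e2, Real.cot_eq_cos_div_sin, Real.cot_eq_cos_div_sin, Real.cos_neg, Real.sin_neg]
    have e3 : Real.cos (φ k - φ j) * Real.sin (φ k + φ j) -
        Real.cos (φ k + φ j) * Real.sin (φ k - φ j) = 2 * (Real.sin (φ j) * Real.cos (φ j)) := by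
      have := Real.sin_sub (φ k + φ j) (φ k - φ j)
      rw [show φ k + φ j - (φ k - φ j) = 2 * φ j by ring, Real.sin_two_mul] at this
      linear_combination -this
    field_simp
    linear_combination 2 * e3
  have hsj := (hs j).ne'
  have hcj := (hc j).ne'
  -- The terms with k = j are cot 0 = 0 and cot(-2φⱼ), the action of the mirror image -φⱼ. As cot 2φ
  -- = (cot φ - tan φ)/2, the latter accounts for the +1 in 2m + 1 and 2m' + 1.
  have hsum : ∑ k, Real.cot (φ k - φ j) + ∑ k, Real.cot (-φ k - φ j) =
      -Real.cos (2 * φ j) / Real.sin (2 * φ j) - (Real.sin (φ j) * Real.cos (φ j)) / 2 *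
      ∑ k ∈ Finset.univ.erase j, 4 / (Real.sin (φ j) ^ 2 - Real.sin (φ k) ^ 2) := by
    rw [← Finset.sum_add_distrib, ← Finset.add_sum_erase _ _ (Finset.mem_univ j),
      Finset.sum_congr rfl hterm, ← Finset.mul_sum, show -φ j - φ j = -(2 * φ j) by ring,
      sub_self, Real.cot_eq_cos_div_sin, Real.cot_eq_cos_div_sin, Real.cos_neg, Real.sin_neg,
      Real.sin_zero, div_zero]
    ring
  have hcr := hcrit j
  rw [hsum, zero_sub, Real.cot_eq_cos_div_sin, Real.cot_eq_cos_div_sin, Real.cos_neg, Real.sin_neg,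
    Real.cos_pi_div_two_sub, Real.sin_pi_div_two_sub, Real.sin_two_mul, Real.cos_two_mul']
  obtain ⟨S, hS⟩ : ∃ S, S = ∑ k ∈ Finset.univ.erase j,
    4 / (Real.sin (φ j) ^ 2 - Real.sin (φ k) ^ 2) := ⟨_, rfl⟩
  rw [← hS] at hcr ⊢
  rw [← Real.cos_sq'] at hcr
  push_cast at hcr
  have hS' : S = -((2 * m + 1) / Real.sin (φ j) ^ 2 - (2 * m' + 1) / Real.cos (φ j) ^ 2) := by
    linarith
  rw [hS']
  field_simp
  ring

/-- The configuration of angles `0, ±φ₁, …, ±φ_N, π / 2`. -/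
def symmetricConfig (m m' : ℕ) (φ : Fin N → ℝ) : PlanarConfig (Fin (N + N + 2)) where
  angle := Fin.cons 0
    (Fin.snoc (Fin.append φ fun k => -φ k) (Real.pi / 2) : Fin (N + N + 1) → ℝ)
  mult := Fin.cons m (Fin.snoc (fun _ : Fin (N + N) => 1) m' : Fin (N + N + 1) → ℕ)

lemma symmetricConfig_cases {P : Fin (N + N + 2) → Prop} (h0 : P 0)
    (h1 : P (Fin.last (N + N + 1))) (hl : ∀ k, P (Fin.castSucc (Fin.castAdd N k)).succ)
    (hr : ∀ k, P (Fin.castSucc (Fin.natAdd N k)).succ) (i : Fin (N + N + 2)) : P i := by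
  induction i using Fin.cases with
  | zero => exact h0
  | succ i =>
    induction i using Fin.lastCases with
    | last => exact h1
    | cast i =>
      induction i using Fin.addCases with
      | left k => exact hl k
      | right k => exact hr k

section

variable (m m' : ℕ) (φ : Fin N → ℝ)

lemma symmetricConfig_angle_zero : (symmetricConfig m m' φ).angle 0 = 0 := rfl

lemma symmetricConfig_angle_last :
    (symmetricConfig m m' φ).angle (Fin.last (N + N + 1)) = Real.pi / 2 := by
  rw [← Fin.succ_last]; simp [symmetricConfig]

lemma symmetricConfig_angle_left (k : Fin N) :
    (symmetricConfig m m' φ).angle (Fin.castSucc (Fin.castAdd N k)).succ = φ k := by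
  simp [symmetricConfig]

lemma symmetricConfig_angle_right (k : Fin N) :
    (symmetricConfig m m' φ).angle (Fin.castSucc (Fin.natAdd N k)).succ = -φ k := by
  simp [symmetricConfig, -Fin.natAdd_eq_addNat, -Fin.castSucc_natAdd]

lemma symmetricConfig_mult_last :
    (symmetricConfig m m' φ).mult (Fin.last (N + N + 1)) = m' := by
  rw [← Fin.succ_last]; simp [symmetricConfig]

lemma symmetricConfig_sum (f : ℝ → ℝ) :
    ∑ i, (symmetricConfig m m' φ).mult i * f ((symmetricConfig m m' φ).angle i) =
      m * f 0 + ((∑ k, f (φ k) + ∑ k, f (-φ k)) + m' * f (Real.pi / 2)) := by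
  rw [Fin.sum_univ_succ, Fin.sum_univ_castSucc, Fin.sum_univ_add]
  simp [symmetricConfig, -Fin.natAdd_eq_addNat, -Fin.castSucc_natAdd]

end

/-- All angles lie in (-π/2, π/2], so distinct angles give distinct lines. The arrangement is
invariant under φ ↦ -φ, and the equation at -φₖ is the negative of the one at φₖ. -/
lemma symmetricConfig_isAmm (m m' : ℕ) {φ : Fin N → ℝ} (hφ : ∀ k, 0 < φ k ∧ φ k < Real.pi / 2)
    (hinj : Function.Injective φ)
    (hloc : ∀ j, m * Real.cot (0 - φ j) + ((∑ k, Real.cot (φ k - φ j) +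
      ∑ k, Real.cot (-φ k - φ j)) + m' * Real.cot (Real.pi / 2 - φ j)) = 0) :
    IsAmm m m' (N + N) (symmetricConfig m m' φ) := by
  have hpi := Real.pi_pos
  have hrange : ∀ i, -(Real.pi / 2) < (symmetricConfig m m' φ).angle i ∧
      (symmetricConfig m m' φ).angle i ≤ Real.pi / 2 := by
    apply symmetricConfig_cases
    · rw [symmetricConfig_angle_zero]; constructor <;> linarith
    · rw [symmetricConfig_angle_last]; constructor <;> linarith
    · intro k
      have := hφ k
      rw [symmetricConfig_angle_left]; constructor <;> linarith
    · intro k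
      have := hφ k
      rw [symmetricConfig_angle_right]; constructor <;> linarith
  have hainj : Function.Injective (symmetricConfig m m' φ).angle := by
    rw [symmetricConfig]
    refine Fin.cons_injective_iff.2 ⟨?_, Fin.snoc_injective_iff.2
      ⟨Fin.append_injective_iff.2 ⟨hinj, neg_injective.comp hinj, fun j k => ?_⟩, ?_⟩⟩
    · rintro ⟨i, hi⟩
      induction i using Fin.lastCases with
      | last => simp at hi
      | cast i =>
        induction i using Fin.addCases with
        | left k => simp at hi; linarith [(hφ k).1]
        | right k => simp [-Fin.natAdd_eq_addNat, -Fin.castSucc_natAdd] at hi; linarith [(hφ k).1]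
    · linarith [(hφ j).1, (hφ k).1]
    · rintro ⟨i, hi⟩
      induction i using Fin.addCases with
      | left k => simp at hi; linarith [(hφ k).2]
      | right k => simp [-Fin.natAdd_eq_addNat, -Fin.castSucc_natAdd] at hi; linarith [(hφ k).1]
  have hreflect : ∀ i, ∃ j, (symmetricConfig m m' φ).line j =
      normalLine (-(symmetricConfig m m' φ).angle i) := by
    apply symmetricConfig_cases
    · exact ⟨0, by rw [symmetricConfig_angle_zero, PlanarConfig.line, symmetricConfig_angle_zero,
        neg_zero]⟩
    · refine ⟨Fin.last _, ?_⟩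
      rw [PlanarConfig.line, symmetricConfig_angle_last]
      exact normalLine_eq_iff.2 ⟨1, by push_cast; ring⟩
    · exact fun k => ⟨_, by rw [PlanarConfig.line, symmetricConfig_angle_right,
        symmetricConfig_angle_left]⟩
    · exact fun k => ⟨_, by rw [PlanarConfig.line, symmetricConfig_angle_left,
        symmetricConfig_angle_right, neg_neg]⟩
  have hmap : ∀ b, (normalLine b).map
      (((symmetricConfig m m' φ).line 0).reflection.toLinearEquiv : Plane →ₗ[ℝ] Plane) =
      normalLine (-b) := by
    intro b
    rw [PlanarConfig.line, symmetricConfig_angle_zero, map_reflection_normalLine]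
    congr 1; ring
  refine ⟨rfl, symmetricConfig_mult_last m m' φ, ?_, fun i j hij => ?_, ?_, ?_, ?_⟩
  · apply symmetricConfig_cases
    · exact fun h => absurd rfl h
    · exact fun _ h => absurd rfl h
    · exact fun k _ _ => by simp [symmetricConfig]
    · exact fun k _ _ => by simp [symmetricConfig]
  · refine linearIndependent_polar.2 fun h0 => hij (hainj ?_)
    have hi := hrange i
    have hj := hrange j
    have := (Real.sin_eq_zero_iff_of_lt_of_lt (by linarith) (by linarith)).1 h0
    linarith
  · rw [PlanarConfig.vec, PlanarConfig.vec, inner_polar, symmetricConfig_angle_zero,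
      symmetricConfig_angle_last, zero_sub, Real.cos_neg, Real.cos_pi_div_two]
  · apply Set.Subset.antisymm
    · rintro _ ⟨_, ⟨i, rfl⟩, rfl⟩
      obtain ⟨j, hj⟩ := hreflect i
      exact ⟨j, hj.trans (hmap _).symm⟩
    · rintro _ ⟨i, rfl⟩
      obtain ⟨j, hj⟩ := hreflect i
      exact ⟨_, ⟨j, rfl⟩, by simp only [hj, hmap, neg_neg]; rfl⟩
  · have key : ∀ i, i ≠ 0 → i ≠ Fin.last (N + N + 1) →
        ∑ k, ((symmetricConfig m m' φ).mult k : ℝ) *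
          Real.cot ((symmetricConfig m m' φ).angle k - (symmetricConfig m m' φ).angle i) = 0 := by
      intro i
      rw [symmetricConfig_sum m m' φ
        (fun x => Real.cot (x - (symmetricConfig m m' φ).angle i))]
      revert i
      apply symmetricConfig_cases
      · exact fun h => absurd rfl h
      · exact fun _ h => absurd rfl h
      · intro k _ _
        rw [symmetricConfig_angle_left]
        exact hloc k
      · intro k _ _
        rw [symmetricConfig_angle_right]
        have hneg : ∀ x : ℝ, Real.cot (-x) = -Real.cot x := fun x => by
          rw [Real.cot_eq_cos_div_sin, Real.cot_eq_cos_div_sin, Real.cos_neg, Real.sin_neg, div_neg]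
        have h1 : ∀ l, Real.cot (φ l - -φ k) = -Real.cot (-φ l - φ k) := fun l => by
          rw [← hneg]; congr 1; ring
        have h2 : ∀ l, Real.cot (-φ l - -φ k) = -Real.cot (φ l - φ k) := fun l => by
          rw [← hneg]; congr 1; ring
        have h3 : Real.cot (0 - -φ k) = -Real.cot (0 - φ k) := by
          rw [← hneg]; congr 1; ring
        have h4 : Real.cot (Real.pi / 2 - -φ k) = -Real.cot (Real.pi / 2 - φ k) := by
          rw [← hneg, Real.cot_eq_cos_div_sin, Real.cot_eq_cos_div_sin,
            show Real.pi / 2 - -φ k = -(Real.pi / 2 - φ k) + Real.pi by ring, Real.cos_add_pi,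
            Real.sin_add_pi, neg_div_neg_eq]
        simp only [h1, h2, h3, h4, Finset.sum_neg_distrib]
        linear_combination -hloc k
    intro j hj0 hj1
    have hk := key j hj0 hj1
    rw [← Finset.add_sum_erase _ _ (Finset.mem_univ j), sub_self, Real.cot_eq_cos_div_sin,
      Real.sin_zero, div_zero, mul_zero, zero_add] at hk
    have : ∀ i, ((symmetricConfig m m' φ).mult i : ℂ) *
        (((symmetricConfig m m' φ).z i + (symmetricConfig m m' φ).z j) /
          ((symmetricConfig m m' φ).z i - (symmetricConfig m m' φ).z j)) = -Complex.I *
        (((symmetricConfig m m' φ).mult i *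
          Real.cot ((symmetricConfig m m' φ).angle i - (symmetricConfig m m' φ).angle j) : ℝ) : ℂ) := by
      intro i
      rw [PlanarConfig.z_add_z_div_z_sub_z, PlanarConfig.cotBetween_cvec, Real.cot_eq_cos_div_sin]
      push_cast
      ring
    simp only [this]
    rw [← Finset.mul_sum, ← Complex.ofReal_sum, hk]
    simp

end Stieltjes

/-- For even `n` the configurations `A_(m, m', 1^n)` exist. -/
theorem exists_isAmm (m m' : ℕ) {n : ℕ} (hn : Even n) :
    ∃ A : PlanarConfig (Fin (n + 2)), IsAmm m m' n A := by
  obtain ⟨N, rfl⟩ := hn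
  -- The exponents are positive even when m or m' is 0, so the endpoints always repel the charges.
  obtain ⟨u, hu, hinj, hcrit⟩ := exists_electrostatic_equilibrium N (2 * m + 1) (2 * m' + 1)
    (by omega) (by omega)
  have hpos : ∀ j, 0 < √(u j) ∧ √(u j) < 1 := fun j =>
    ⟨Real.sqrt_pos.2 (hu j).1, by rw [Real.sqrt_lt' one_pos]; simpa using (hu j).2⟩
  have hsin : ∀ j, Real.sin (Real.arcsin √(u j)) = √(u j) := fun j =>
    Real.sin_arcsin (by linarith [(hpos j).1]) (hpos j).2.le
  have hsq : ∀ j, Real.sin (Real.arcsin √(u j)) ^ 2 = u j := fun j => by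
    rw [hsin, Real.sq_sqrt (hu j).1.le]
  have hφ : ∀ j, 0 < Real.arcsin √(u j) ∧ Real.arcsin √(u j) < Real.pi / 2 := fun j =>
    ⟨Real.arcsin_pos.2 (hpos j).1, Real.arcsin_lt_pi_div_two.2 (hpos j).2⟩
  refine ⟨symmetricConfig m m' fun j => Real.arcsin √(u j),
    symmetricConfig_isAmm m m' hφ (fun i j hij => hinj ?_) ?_⟩
  · rw [← hsq i, ← hsq j]
    exact congrArg (fun x => Real.sin x ^ 2) hij
  · apply cot_sum_eq_zero_of_equilibrium
    · intro j; rw [hsin]; exact (hpos j).1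
    · exact fun j => Real.cos_pos_of_mem_Ioo ⟨by linarith [(hφ j).1, Real.pi_pos], (hφ j).2⟩
    · intro j k hjk
      rw [hsq, hsq]
      exact sub_ne_zero.2 (hinj.ne hjk)
    · intro j
      simp only [hsq]
      exact hcrit j

/-! ### Dihedral groups -/

section Dihedral

lemma finrank_normalLine (a : ℝ) : Module.finrank ℝ (normalLine a) = 1 := by
  have : Fact (Module.finrank ℝ Plane = 1 + 1) := ⟨by simp⟩
  exact Submodule.finrank_orthogonal_span_singleton (polar_ne_zero a)

lemma exists_polar_eq {v : Plane} (hv : ‖v‖ = 1) : ∃ a, v = polar a := by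
  have h : (v 0) ^ 2 + (v 1) ^ 2 = 1 := by
    have := EuclideanSpace.norm_sq_eq v
    rw [hv, Fin.sum_univ_two] at this
    simpa using this.symm
  have hz : ‖(⟨v 0, v 1⟩ : ℂ)‖ = 1 := by
    rw [← sq_eq_sq₀ (norm_nonneg _) zero_le_one, Complex.sq_norm, Complex.normSq_mk]
    linarith
  have hz0 : (⟨v 0, v 1⟩ : ℂ) ≠ 0 := by
    rw [← norm_ne_zero_iff, hz]; exact one_ne_zero
  refine ⟨Complex.arg ⟨v 0, v 1⟩, ?_⟩
  ext i
  fin_cases i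
  · simp [Complex.cos_arg hz0, hz]
  · simp [Complex.sin_arg, hz]

lemma exists_eq_normalLine {ℓ : Submodule ℝ Plane} (h : Module.finrank ℝ ℓ = 1) :
    ∃ a, ℓ = normalLine a := by
  have hperp : Module.finrank ℝ ℓᗮ = 1 := by
    have := Submodule.finrank_add_finrank_orthogonal ℓ
    rw [h, finrank_euclideanSpace_fin] at this
    omega
  obtain ⟨v, hv0, hv⟩ := finrank_eq_one_iff'.1 hperp
  have hv0' : (v : Plane) ≠ 0 := by simpa using hv0
  have hn : ‖(v : Plane)‖ ≠ 0 := norm_ne_zero_iff.2 hv0'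
  obtain ⟨a, ha⟩ := exists_polar_eq (v := (‖(v : Plane)‖⁻¹) • (v : Plane)) (by
    rw [norm_smul, norm_inv, norm_norm, inv_mul_cancel₀ hn])
  refine ⟨a, ?_⟩
  rw [normalLine, ← ha, Submodule.span_singleton_smul_eq (inv_ne_zero hn).isUnit]
  refine (Submodule.orthogonal_orthogonal ℓ).symm.trans (congrArg _ ?_)
  refine le_antisymm (fun w hw => ?_) ?_
  · obtain ⟨c, hc⟩ := hv ⟨w, hw⟩
    exact Submodule.mem_span_singleton.2 ⟨c, congrArg Subtype.val hc⟩
  · rw [Submodule.span_singleton_le_iff_mem]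
    exact v.2

variable {q : ℕ} {θ : ℝ}

lemma reflection_mem_dihedralI2 (hq : 1 ≤ q) (i : ℤ) :
    (normalLine (θ + Real.pi * i / (2 * q : ℕ))).reflection ∈ dihedralI2 (2 * q) θ := by
  obtain ⟨s, k, hs⟩ := exists_fin_add_one_eq (q := 2 * q) (by omega) (i + 1)
  have hs' : ((s : ℕ) : ℝ) + 1 = (i + 1) + (2 * q : ℕ) * k := by exact_mod_cast hs
  have hq0 : ((2 * q : ℕ) : ℝ) ≠ 0 := by exact_mod_cast (by omega : 2 * q ≠ 0)
  have : normalLine (θ + Real.pi * i / (2 * q : ℕ)) =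
      normalLine (θ + Real.pi * (s : ℕ) / (2 * q : ℕ)) := by
    refine normalLine_eq_iff.2 ⟨-k, ?_⟩
    have e : ((s : ℕ) : ℝ) = i + (2 * q : ℕ) * k := by linarith
    rw [e]
    field_simp
    push_cast
    ring
  rw [this]
  exact Subgroup.subset_closure ⟨s, rfl⟩

/-- The elements of `I₂(2 q)` are rotations and reflections. -/
lemma polar_of_mem_dihedralI2 (hq : 1 ≤ q) {g : Plane ≃ₗᵢ[ℝ] Plane}
    (hg : g ∈ dihedralI2 (2 * q) θ) : ∃ j : ℤ,
      (∀ χ, g (polar χ) = polar (χ + Real.pi * j / q)) ∨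
      (∀ χ, g (polar χ) = polar (2 * θ + Real.pi * j / q - χ)) := by
  have hq0 : (q : ℝ) ≠ 0 := by exact_mod_cast (by omega : q ≠ 0)
  induction hg using Subgroup.closure_induction with
  | mem x hx =>
    obtain ⟨i, rfl⟩ := hx
    -- The shift by q absorbs the π = πq/q in `reflection_normalLine_polar`.
    refine ⟨(i : ℕ) + q, Or.inr fun χ => ?_⟩
    rw [reflection_normalLine_polar]
    congr 1
    push_cast
    field_simp
    ring
  | one => exact ⟨0, Or.inl fun χ => by simp⟩
  | mul x y _ _ hx hy =>
    obtain ⟨i, hx | hx⟩ := hx <;> obtain ⟨j, hy | hy⟩ := hy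
    · refine ⟨i + j, Or.inl fun χ => ?_⟩
      rw [show (x * y) (polar χ) = x (y (polar χ)) from rfl, hy, hx]
      congr 1; push_cast; ring
    · refine ⟨i + j, Or.inr fun χ => ?_⟩
      rw [show (x * y) (polar χ) = x (y (polar χ)) from rfl, hy, hx]
      congr 1; push_cast; ring
    · refine ⟨i - j, Or.inr fun χ => ?_⟩
      rw [show (x * y) (polar χ) = x (y (polar χ)) from rfl, hy, hx]
      congr 1; push_cast; ring
    · refine ⟨i - j, Or.inl fun χ => ?_⟩
      rw [show (x * y) (polar χ) = x (y (polar χ)) from rfl, hy, hx]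
      congr 1; push_cast; ring
  | inv x _ hx =>
    obtain ⟨i, hx | hx⟩ := hx
    · refine ⟨-i, Or.inl fun χ => ?_⟩
      have := hx (χ + Real.pi * (-i : ℤ) / q)
      rw [show χ + Real.pi * (-i : ℤ) / q + Real.pi * i / q = χ by push_cast; ring] at this
      rw [← this]
      exact x.symm_apply_apply _
    · refine ⟨i, Or.inr fun χ => ?_⟩
      have := hx (2 * θ + Real.pi * i / q - χ)
      rw [sub_sub_cancel] at this
      conv_lhs => rw [← this]
      exact x.symm_apply_apply _

lemma mem_mirrors_dihedralI2 (hq : 1 ≤ q) {ℓ : Submodule ℝ Plane} :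
    ℓ ∈ mirrors (dihedralI2 (2 * q) θ) ↔
      ∃ i : ℤ, ℓ = normalLine (θ + Real.pi * i / (2 * q : ℕ)) := by
  have hq0 : (q : ℝ) ≠ 0 := by exact_mod_cast (by omega : q ≠ 0)
  constructor
  · rintro ⟨h1, h2⟩
    obtain ⟨a, rfl⟩ := exists_eq_normalLine h1
    have key : ∀ x y : ℝ, polar x = polar y → Real.cos (x - y) = 1 := fun x y hxy => by
      rw [← inner_polar, hxy, inner_polar, sub_self, Real.cos_zero]
    obtain ⟨j, hj | hj⟩ := polar_of_mem_dihedralI2 hq h2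
    -- A reflection is not a rotation: passing from χ = 0 to χ = π/2 changes the difference of the
    -- two image angles by π, so its cosine cannot be 1 both times.
    · exfalso
      have e1 := hj 0
      have e2 := hj (Real.pi / 2)
      rw [reflection_normalLine_polar] at e1 e2
      have c1 := key _ _ e1
      have c2 := key _ _ e2
      rw [show 2 * a + Real.pi - Real.pi / 2 - (Real.pi / 2 + Real.pi * j / q) =
        2 * a + Real.pi - 0 - (0 + Real.pi * j / q) - Real.pi by ring, Real.cos_sub_pi, c1] at c2
      norm_num at c2
    · have e := hj 0
      rw [reflection_normalLine_polar] at e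
      obtain ⟨k, hk⟩ := (Real.cos_eq_one_iff _).1 (key _ _ e)
      refine ⟨j - q, normalLine_eq_iff.2 ⟨k, ?_⟩⟩
      push_cast
      field_simp
      field_simp at hk
      linarith
  · rintro ⟨i, rfl⟩
    exact ⟨finrank_normalLine _, reflection_mem_dihedralI2 hq i⟩

lemma map_mul_isometry (g h : Plane ≃ₗᵢ[ℝ] Plane) (ℓ : Submodule ℝ Plane) :
    ℓ.map ((g * h).toLinearEquiv : Plane →ₗ[ℝ] Plane) =
      (ℓ.map (h.toLinearEquiv : Plane →ₗ[ℝ] Plane)).map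
        (g.toLinearEquiv : Plane →ₗ[ℝ] Plane) := by
  rw [← Submodule.map_comp]; rfl

lemma mem_orbit_normalLine (hq : 1 ≤ q) (χ : ℝ) {ℓ : Submodule ℝ Plane} :
    (∃ g ∈ dihedralI2 (2 * q) θ,
      ℓ = (normalLine χ).map (g.toLinearEquiv : Plane →ₗ[ℝ] Plane)) ↔
    ∃ j : ℤ, ℓ = normalLine (χ + Real.pi * j / q) ∨
      ℓ = normalLine (2 * θ + Real.pi * j / q - χ) := by
  have hq0 : (q : ℝ) ≠ 0 := by exact_mod_cast (by omega : q ≠ 0)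
  constructor
  · rintro ⟨g, hg, rfl⟩
    obtain ⟨j, hj | hj⟩ := polar_of_mem_dihedralI2 hq hg
    · exact ⟨j, Or.inl (map_normalLine (hj χ))⟩
    · exact ⟨j, Or.inr (map_normalLine (hj χ))⟩
  · rintro ⟨j, rfl | rfl⟩
    -- Rotation by πj/q is the product of the reflections with normal angles θ + πj/(2q) and θ.
    · refine ⟨_, mul_mem (reflection_mem_dihedralI2 hq j) (reflection_mem_dihedralI2 hq 0), ?_⟩
      rw [map_mul_isometry, map_reflection_normalLine, map_reflection_normalLine]
      congr 1
      push_cast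
      field_simp
      ring
    · refine ⟨_, reflection_mem_dihedralI2 hq j, ?_⟩
      rw [map_reflection_normalLine]
      congr 1
      push_cast
      field_simp

/-- A fixed-point-free involution splits S into pairs, and the smaller element of each pair is
chosen; σ exchanges smaller and larger elements, so there are n/2 of them. -/
lemma exists_transversal {ι : Type*} [LinearOrder ι] (S : Finset ι) (σ : ι → ι)
    (hS : ∀ i ∈ S, σ i ∈ S) (hσ : ∀ i, σ (σ i) = i) (hfix : ∀ i ∈ S, σ i ≠ i) {n : ℕ}
    (hn : S.card = n) :
    ∃ f : Fin (n / 2) → ι, Function.Injective f ∧ (∀ k, f k ∈ S) ∧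
      (∀ k l, f k ≠ σ (f l)) ∧ ∀ i ∈ S, ∃ k, i = f k ∨ i = σ (f k) := by
  have hcard : (S.filter fun i => i < σ i).card = (S.filter fun i => ¬ i < σ i).card := by
    refine Finset.card_bij' (fun i _ => σ i) (fun i _ => σ i) ?_ ?_ (fun i _ => hσ i)
      (fun i _ => hσ i)
    · intro i hi
      rw [Finset.mem_filter] at hi ⊢
      exact ⟨hS i hi.1, by rw [hσ]; exact hi.2.not_gt⟩
    · intro i hi
      rw [Finset.mem_filter] at hi ⊢
      exact ⟨hS i hi.1, by rw [hσ]; exact lt_of_le_of_ne (not_lt.1 hi.2) (hfix i hi.1)⟩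
  have hsum := Finset.card_filter_add_card_filter_not (s := S) (fun i => i < σ i)
  have hU : (S.filter fun i => i < σ i).card = n / 2 := by omega
  have e := (S.filter fun i => i < σ i).equivFinOfCardEq hU
  have hmem : ∀ k, (e.symm k : ι) ∈ S ∧ (e.symm k : ι) < σ (e.symm k) := fun k =>
    Finset.mem_filter.1 (e.symm k).2
  refine ⟨fun k => e.symm k, Subtype.val_injective.comp e.symm.injective, fun k => (hmem k).1,
    fun k l h => ?_, fun i hi => ?_⟩
  · have h1 := (hmem k).2
    have h2 := (hmem l).2
    simp only at h
    rw [h, hσ] at h1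
    exact lt_asymm h1 h2
  · rcases lt_or_gt_of_ne (hfix i hi) with h | h
    · refine ⟨e ⟨σ i, Finset.mem_filter.2 ⟨hS i hi, by rwa [hσ]⟩⟩, Or.inr ?_⟩
      simp [hσ]
    · exact ⟨e ⟨i, Finset.mem_filter.2 ⟨hi, h⟩⟩, Or.inl (by simp)⟩

end Dihedral

/-! ### Decomposition of the unfolded arrangement into dihedral orbits. -/

namespace IsAmm

variable {m m' n : ℕ} {A : PlanarConfig (Fin (n + 2))} {q : ℕ}

/-- The lines of `T q A` lying over the line `i` of `A`. -/
def linesOver (A : PlanarConfig (Fin (n + 2))) (q : ℕ) (i : Fin (n + 2)) :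
    Set (Submodule ℝ Plane) :=
  {ℓ | ∃ x : ℤ, ℓ = normalLine ((A.angle i + x * Real.pi) / q)}

lemma T_line_mem_linesOver (i : Fin (n + 2)) (s : Fin q) :
    (A.T q).line (i, s) ∈ linesOver A q i :=
  ⟨(s : ℕ) + 1, by rw [PlanarConfig.line, PlanarConfig.T]; congr 1; push_cast; ring⟩

lemma range_T_line (hq : 1 ≤ q) : Set.range (A.T q).line = ⋃ i, linesOver A q i := by
  ext ℓ
  rw [Set.mem_iUnion]
  constructor
  · rintro ⟨⟨i, s⟩, rfl⟩
    exact ⟨i, T_line_mem_linesOver i s⟩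
  · rintro ⟨i, x, rfl⟩
    obtain ⟨s, k, hs⟩ := A.exists_T_angle_eq hq i x
    exact ⟨(i, s), normalLine_eq_iff.2 ⟨k, hs⟩⟩

/-- Starting from φᵢ/q, rotations sweep out the lines over i, and reflections those over j, because
2φ₀/q - φᵢ/q = (φⱼ - kπ)/q. If j = i, the two families coincide. -/
lemma isLineOrbit_linesOver (hq : 1 ≤ q) {i j : Fin (n + 2)} {k : ℤ}
    (hk : A.angle j = 2 * A.angle 0 - A.angle i + k * Real.pi) :
    IsLineOrbit (dihedralI2 (2 * q) (A.angle 0 / q)) (linesOver A q i ∪ linesOver A q j) := by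
  have hq0 : (q : ℝ) ≠ 0 := by exact_mod_cast (by omega : q ≠ 0)
  refine ⟨normalLine (A.angle i / q), finrank_normalLine _, ?_⟩
  ext ℓ
  rw [Set.mem_ofPred_eq, mem_orbit_normalLine hq]
  constructor
  · rintro (⟨x, rfl⟩ | ⟨x, rfl⟩)
    · refine ⟨x, Or.inl ?_⟩
      congr 1
      ring
    · refine ⟨x + k, Or.inr ?_⟩
      rw [hk]
      congr 1
      push_cast
      ring
  · rintro ⟨x, rfl | rfl⟩
    · refine Or.inl ⟨x, ?_⟩
      congr 1
      ring
    · refine Or.inr ⟨x - k, ?_⟩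
      rw [hk]
      congr 1
      push_cast
      ring

variable (h : IsAmm m m' n A)

include h

lemma eq_of_mem_linesOver (hq : 1 ≤ q) {i j : Fin (n + 2)} {ℓ : Submodule ℝ Plane}
    (hi : ℓ ∈ linesOver A q i) (hj : ℓ ∈ linesOver A q j) : i = j := by
  have hq0 : (q : ℝ) ≠ 0 := by exact_mod_cast (by omega : q ≠ 0)
  obtain ⟨x, rfl⟩ := hi
  obtain ⟨y, hy⟩ := hj
  obtain ⟨k, hk⟩ := normalLine_eq_iff.1 hy
  refine h.eq_of_angle_eq (k := y - x + q * k) ?_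
  field_simp at hk
  push_cast
  linarith

/-- Mirrors have normal angles φ₀/q + πi/(2q). Even i give the lines over α₀, and odd i those over
α_{n+1}, where the angle is φ₀ + π/2 modulo π. -/
lemma mirrors_eq (hq : 1 ≤ q) : mirrors (dihedralI2 (2 * q) (A.angle 0 / q)) =
    linesOver A q 0 ∪ linesOver A q (Fin.last (n + 1)) := by
  have hq0 : (q : ℝ) ≠ 0 := by exact_mod_cast (by omega : q ≠ 0)
  obtain ⟨k, hk⟩ := h.angle_last
  ext ℓ
  rw [mem_mirrors_dihedralI2 hq]
  constructor
  · rintro ⟨i, rfl⟩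
    rcases Int.even_or_odd' i with ⟨l, rfl | rfl⟩
    · refine Or.inl ⟨l, ?_⟩
      congr 1
      push_cast
      field_simp
    · refine Or.inr ⟨l - k, ?_⟩
      rw [hk]
      congr 1
      push_cast
      field_simp
      ring
  · rintro (⟨x, rfl⟩ | ⟨x, rfl⟩)
    · refine ⟨2 * x, ?_⟩
      congr 1
      push_cast
      field_simp
    · refine ⟨2 * (x + k) + 1, ?_⟩
      rw [hk]
      congr 1
      push_cast
      field_simp
      ring

/-- The reflection about α₀ induces an involution σ of the indices, whose only fixed points are 0
and n + 1. These give the two orbits of mirrors; each pair {i, σ i} gives one further orbit,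
represented by a transversal. -/
lemma isDihedralArrangement_T (hq : 1 ≤ q) :
    IsDihedralArrangement q m m' (n / 2) (A.T q) := by
  choose σ k hσ using h.exists_reflect
  have hinv : ∀ i, σ (σ i) = i := fun i =>
    h.eq_of_angle_eq (k := k (σ i) - k i) (by rw [hσ (σ i), hσ i]; push_cast; ring)
  have hσS : ∀ i, (σ i = 0 ∨ σ i = Fin.last (n + 1)) ↔ (i = 0 ∨ i = Fin.last (n + 1)) :=
    fun i => h.reflect_eq_zero_or_last_iff (hσ i)
  have hfixed : ∀ i, σ i = i ↔ (i = 0 ∨ i = Fin.last (n + 1)) := by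
    intro i
    rw [h.eq_zero_or_eq_last_iff]
    constructor
    · intro hi
      have := hσ i
      rw [hi] at this
      exact ⟨k i, by linarith⟩
    · rintro ⟨l, hl⟩
      exact h.eq_of_angle_eq (k := k i - l) (by rw [hσ i]; push_cast; linarith)
  obtain ⟨S, hSdef⟩ : ∃ S : Finset (Fin (n + 2)), S =
    (Finset.univ.erase 0).erase (Fin.last (n + 1)) := ⟨_, rfl⟩
  have hS : ∀ i, i ∈ S ↔ ¬ (i = 0 ∨ i = Fin.last (n + 1)) := by
    intro i
    simp [hSdef, not_or, and_comm]
  have hScard : S.card = n := by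
    rw [hSdef, Finset.card_erase_of_mem (by simp [Fin.ext_iff]), Finset.card_erase_of_mem (by simp)]
    simp
  obtain ⟨f, hfinj, hfS, hfσ, hfsurj⟩ := exists_transversal S σ
    (fun i hi => by rw [hS, hσS, ← hS]; exact hi) hinv
    (fun i hi => by rw [Ne, hfixed, ← hS]; exact hi) hScard
  have hsub : ∀ k, f k ∈ S ∧ σ (f k) ∈ S := fun k =>
    ⟨hfS k, by rw [hS, hσS, ← hS]; exact hfS k⟩
  have h0 : ∀ i ∈ S, i ≠ 0 ∧ i ≠ Fin.last (n + 1) := fun i hi => not_or.1 ((hS i).1 hi)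
  have hnm : ∀ i ∈ S, Disjoint (linesOver A q i)
      (mirrors (dihedralI2 (2 * q) (A.angle 0 / q))) := by
    intro i hi
    rw [h.mirrors_eq hq, Set.disjoint_left]
    rintro ℓ h1 (h2 | h2)
    · exact (h0 i hi).1 (h.eq_of_mem_linesOver hq h1 h2)
    · exact (h0 i hi).2 (h.eq_of_mem_linesOver hq h1 h2)
  have hlines : ∀ (a : Fin (n + 2) × Fin q) {i}, (A.T q).line a ∈ linesOver A q i → a.1 = i :=
    fun a i ha => h.eq_of_mem_linesOver hq (T_line_mem_linesOver a.1 a.2) ha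
  have horbit : ∀ i, σ i = i →
      IsLineOrbit (dihedralI2 (2 * q) (A.angle 0 / q)) (linesOver A q i) := by
    intro i hi
    have := isLineOrbit_linesOver (q := q) hq (hσ i)
    rwa [hi, Set.union_self] at this
  refine ⟨A.angle 0 / q, linesOver A q 0, linesOver A q (Fin.last (n + 1)),
    fun k => linesOver A q (f k) ∪ linesOver A q (σ (f k)), horbit _ ((hfixed 0).2 (Or.inl rfl)),
    horbit _ ((hfixed _).2 (Or.inr rfl)), ?_, (h.mirrors_eq hq).symm,
    fun k => isLineOrbit_linesOver hq (hσ _), fun k l hkl => ?_,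
    fun k => Set.disjoint_union_left.2 ⟨hnm _ (hsub k).1, hnm _ (hsub k).2⟩, ?_, ?_, ?_, ?_⟩
  · rw [Set.disjoint_left]
    intro ℓ h1 h2
    have := h.eq_of_mem_linesOver hq h1 h2
    simp [Fin.ext_iff] at this
  · refine Set.disjoint_left.2 ?_
    rintro ℓ (h1 | h1) (h2 | h2)
    · exact hkl (hfinj (h.eq_of_mem_linesOver hq h1 h2))
    · exact hfσ k l (h.eq_of_mem_linesOver hq h1 h2)
    · exact hfσ l k (h.eq_of_mem_linesOver hq h2 h1)
    · have := congrArg σ (h.eq_of_mem_linesOver hq h1 h2)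
      rw [hinv, hinv] at this
      exact hkl (hfinj this)
  · rw [range_T_line hq, h.mirrors_eq hq]
    ext ℓ
    simp only [Set.mem_iUnion, Set.mem_union]
    constructor
    · rintro ⟨i, hi⟩
      by_cases hiS : i ∈ S
      · obtain ⟨k, rfl | rfl⟩ := hfsurj i hiS
        · exact Or.inr ⟨k, Or.inl hi⟩
        · exact Or.inr ⟨k, Or.inr hi⟩
      · rw [hS, not_not] at hiS
        rcases hiS with rfl | rfl
        · exact Or.inl (Or.inl hi)
        · exact Or.inl (Or.inr hi)
    · rintro ((hℓ | hℓ) | ⟨k, hℓ | hℓ⟩) <;> exact ⟨_, hℓ⟩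
  · intro a ha
    rw [PlanarConfig.T_mult, hlines a ha, h.mult_zero]
  · intro a ha
    rw [PlanarConfig.T_mult, hlines a ha, h.mult_last]
  · rintro k a (ha | ha) <;> rw [PlanarConfig.T_mult, hlines a ha]
    · exact h.mult_one _ (h0 _ (hsub k).1).1 (h0 _ (hsub k).1).2
    · exact h.mult_one _ (h0 _ (hsub k).2).1 (h0 _ (hsub k).2).2

end IsAmm

end BakerAkhiezer

end

theorem corollary3p4 (m m' n : ℕ) (hn : Even n) :
    (∃ A : BakerAkhiezer.PlanarConfig (Fin (n + 2)), BakerAkhiezer.IsAmm m m' n A) ∧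
    ∀ A : BakerAkhiezer.PlanarConfig (Fin (n + 2)), BakerAkhiezer.IsAmm m m' n A →
      ∀ q : ℕ, 1 ≤ q →
        BakerAkhiezer.IsConfiguration (A.T q).cvec ∧
        BakerAkhiezer.AdmitsBA (A.T q).cvec (A.T q).mult ∧
        BakerAkhiezer.IsDihedralArrangement q m m' (n / 2) (A.T q) :=
  ⟨BakerAkhiezer.exists_isAmm m m' hn, fun _ hA _ hq =>
    ⟨hA.isConfiguration_T hq, hA.admitsBA_T hq, hA.isDihedralArrangement_T hq⟩⟩
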